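/- Let $\Gamma$ be a discrete group with a left-invariant metric $d$ and the counting measure, let $V$ be a complex Hilbert space, and let $A$ be a bounded self-adjoint operator on $\mathcal H=\ell^2(\Gamma,V)$ which commutes with the left translations $(g\cdot f)(x)=f(g^{-1}x)$ and is local at scale $r$: $Af(x)$ depends only on the values of $f$ on the ball $\{y: d(x,y)\le r\}$. Write $\tau$ for the trace and $\chi_\Omega$ for multiplication by the indicator function of $\Omega\subset\Gamma$. For $\mu\in\mathbb R$ let $\Pi_\mu=\Pi_{]-\infty,\mu[}(A)$ be the spectral projection; put $F_\Omega(\mu)=\tau(\chi_\Omega\Pi_\mu\chi_\Omega)\in[0,\infty]$ and $F_x(\mu)=\sum_i\|(\Pi_\mu e_i)(x)\|_V^2$ for any Hilbert basis $(e_i)$ of $\mathcal H$. For an increasing $G:\mathbb R\to[0,\infty]$ set $G^{-1}(u)=\sup\{t\in\mathbb R: G(t)\le u\}\in[-\infty,+\infty]$, and let $\varphi_\Omega(y)=\int_0^yF_\Omega^{-1}(u)\,du$, $\varphi_x(y)=\int_0^yF_x^{-1}(u)\,du$. The energy of a positive trace class operator $\rho$ is $\mathcal E(\rho)=\tau(\rho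 A)$, and $\|\rho\|_\infty$ is its operator norm. Fix $\lambda\in\mathbb R$ such that $F_x(\lambda)<\infty$ for all $x$ (this is automatic if $\dim V<\infty$, in particular for scalar operators). Let $(\Omega_n)$ be a sequence of nonempty finite subsets of $\Gamma$ with $|\partial_r\Omega_n|/|\Omega_n|\to0$, where $|\cdot|$ is the cardinality and $\partial_r\Omega=\{x\in\Gamma: d(x,\Omega)\le r \text{ and } d(x,\Gamma\setminus\Omega)\le r\}$ (for instance a Følner sequence, when $\Gamma$ is infinite and amenable and the balls of $d$ are finite). Let $\rho_\Omega=\chi_\Omega\Pi_\lambda\chi_\Omega$. Then $F:=F_x$, and hence $\varphi:=\varphi_x$, do not depend on $x\in\Gamma$; each $\rho_{\Omega_n}$ is positive and trace class, $\rho_{\Omega_n}A$ is trace class with real trace; the numbers $\varphi_{\Omega_n}\bigl(\tau(\rho_{\Omega_n})/\|\rho_{\Omega_n}\|_\infty\bigr)$ and $\varphi(F(\lambda))$ are finite; and $$\lim_{n\to\infty}\frac{\mathcal E(\rho_{\Omega_n})}{|\Omega_n|}=\lim_{n\to\infty}\frac{\|\rho_{\Omega_n}\|_\infty}{|\Omega_n|}\,\varphi_{\Omega_n}\Bigl(\frac{\tau(\rho_{\Omega_n})}{\|\rho_{\Omega_n}\|_\infty}\Bigr)=\varphi(F(\lambda)).$$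 (When $\rho_{\Omega_n}=0$, the second expression is read as $0$.) -/

import Mathlib

open Filter Topology MeasureTheory
open scoped ENNReal

noncomputable section

namespace ConfinedState

/-! ### Traces on a Hilbert space -/

section Trace

universe u

variable {H : Type u} [NormedAddCommGroup H] [InnerProductSpace ℂ H] [CompleteSpace H]

/-- `T` is trace class with trace `t`: in every Hilbert basis, the diagonal coefficients of `T` are
(unconditionally) summable, with sum `t`. -/
def HasTrace (T : H →L[ℂ] H) (t : ℂ) : Prop :=
  ∀ (ι : Type u) (b : HilbertBasis ι ℂ H), HasSum (fun i => inner ℂ (b i) (T (b i))) t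

open Classical in
/-- The trace of a trace class operator (and `0` for the other operators). -/
def trace (T : H →L[ℂ] H) : ℂ :=
  if h : ∃ t, HasTrace T t then h.choose else 0

variable (H) in
/-- The index set of a Hilbert basis of `H`, chosen once and for all. -/
def basisSet : Set H := (exists_hilbertBasis ℂ H).choose

variable (H) in
/-- A Hilbert basis of `H`, chosen once and for all. -/
def hilbBasis : HilbertBasis (basisSet H) ℂ H := (exists_hilbertBasis ℂ H).choose_spec.choose

/-- The trace, with values in `[0, ∞]`, of a positive bounded operator (its value does not depend
on the Hilbert basis). -/
def posTrace (P : H →L[ℂ] H) : ℝ≥0∞ :=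
  ∑' i, ENNReal.ofReal (RCLike.re (inner ℂ (hilbBasis H i) (P (hilbBasis H i))))

/-- A (mixed) state: a positive trace class operator. -/
def IsState (ρ : H →L[ℂ] H) : Prop := ρ.IsPositive ∧ posTrace ρ ≠ ∞

/-- The energy `τ(ρ A)` of the state `ρ`, for a bounded self-adjoint operator `A`. -/
def energy (A ρ : H →L[ℂ] H) : ℝ := (trace (ρ ∘L A)).re

/-- The square root `P^{1/2}` of a positive bounded operator. -/
def sqrtOp (P : H →L[ℂ] H) : H →L[ℂ] H := cfc Real.sqrt P

/-- The spectral subspace of the bounded self-adjoint operator `A` for the interval `(-∞, lam)`: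
the closure of the range of `f(A)`, where `f(t) = max (lam - t) 0` vanishes exactly off
`(-∞, lam)`. -/
def spectralSubspace (A : H →L[ℂ] H) (lam : ℝ) : Submodule ℂ H :=
  (LinearMap.range (cfc (fun t : ℝ => max (lam - t) 0) A : H →L[ℂ] H).toLinearMap).topologicalClosure

instance (A : H →L[ℂ] H) (lam : ℝ) : CompleteSpace (spectralSubspace A lam) :=
  (Submodule.isClosed_topologicalClosure _).completeSpace_coe

/-- The spectral projection `Π_lam` of `A` for the open half-line `(-∞, lam)`. -/
def spectralProj (A : H →L[ℂ] H) (lam : ℝ) : H →L[ℂ] H :=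
  (spectralSubspace A lam).starProjection

end Trace

/-! ### The function `φ` attached to an increasing function `F` -/

/-- The pseudo-inverse `F⁻¹(y) = sup {x ∈ ℝ | F x ≤ y} ∈ [-∞, +∞]`. -/
def pseudoInv (F : ℝ → ℝ≥0∞) (y : ℝ≥0∞) : EReal :=
  sSup ((fun x : ℝ => (x : EReal)) '' {x : ℝ | F x ≤ y})

/-- `φ(y) = ∫₀^y F⁻¹(u) du`, with values in `[-∞, +∞]`: the integral of the positive part of `F⁻¹`
minus that of its negative part. -/
def phi (F : ℝ → ℝ≥0∞) (y : ℝ≥0∞) : EReal :=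
  ((∫⁻ u in {u : ℝ | 0 < u ∧ ENNReal.ofReal u ≤ y},
      (pseudoInv F (ENNReal.ofReal u)).toENNReal : ℝ≥0∞) : EReal) -
  ((∫⁻ u in {u : ℝ | 0 < u ∧ ENNReal.ofReal u ≤ y},
      (-pseudoInv F (ENNReal.ofReal u)).toENNReal : ℝ≥0∞) : EReal)

/-! ### Operators on `ℓ²(X, V)` -/

/-- The Hilbert space `L²(X, V) = L²(X) ⊗ V`, for the counting measure on `X`. -/
abbrev L2 (X V : Type*) [NormedAddCommGroup V] := lp (fun _ : X => V) 2

section Discrete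

variable {X V : Type*} [NormedAddCommGroup V]

theorem memℓp_indicator (Ω : Set X) (f : L2 X V) : Memℓp (Ω.indicator (f : X → V)) 2 := by
  refine memℓp_gen (Summable.of_nonneg_of_le (fun i => by positivity) (fun i => ?_)
    ((memℓp_gen_iff (by norm_num)).1 (lp.memℓp f)))
  gcongr
  exact norm_indicator_le_norm_self _ _

theorem norm_indicator_le (Ω : Set X) (f : L2 X V) :
    ‖(⟨Ω.indicator (f : X → V), memℓp_indicator Ω f⟩ : L2 X V)‖ ≤ 1 * ‖f‖ := by
  rw [one_mul]
  refine lp.norm_mono (by norm_num) (fun i => ?_)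
  exact norm_indicator_le_norm_self _ _

variable [InnerProductSpace ℂ V] [CompleteSpace V]

/-- The operator `χ_Ω` of multiplication by the indicator function of `Ω`. -/
def chi (Ω : Set X) : L2 X V →L[ℂ] L2 X V :=
  LinearMap.mkContinuous
    { toFun := fun f => ⟨Ω.indicator (f : X → V), memℓp_indicator Ω f⟩
      map_add' := fun f g => by
        refine lp.ext ?_
        exact Set.indicator_add Ω (f : X → V) (g : X → V)
      map_smul' := fun c f => by
        refine lp.ext ?_
        exact Set.indicator_const_smul Ω c (f : X → V) }
    1 (norm_indicator_le Ω)

/-- The measure `ν_P(Ω) = τ(χ_Ω P χ_Ω)` of a positive bounded operator `P`. -/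
def nu (P : L2 X V →L[ℂ] L2 X V) (Ω : Set X) : ℝ≥0∞ :=
  posTrace (chi Ω ∘L P ∘L chi Ω)

/-- The density function `Dν_P(x) = ∑ᵢ ‖(P^{1/2} eᵢ)(x)‖²` of a positive bounded operator `P`. -/
def density (P : L2 X V →L[ℂ] L2 X V) (x : X) : ℝ≥0∞ :=
  ∑' i, ‖(sqrtOp P (hilbBasis (L2 X V) i) : X → V) x‖ₑ ^ 2

/-- The spectral measure `F_Ω(lam) = ν_{Π_lam}(Ω)` of `Ω`. -/
def spectralMeasure (A : L2 X V →L[ℂ] L2 X V) (Ω : Set X) (lam : ℝ) : ℝ≥0∞ :=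
  nu (spectralProj A lam) Ω

/-- The spectral density function `F_x(lam) = Dν_{Π_lam}(x)`. -/
def spectralDensity (A : L2 X V →L[ℂ] L2 X V) (x : X) (lam : ℝ) : ℝ≥0∞ :=
  density (spectralProj A lam) x

open Classical in
/-- The spectral density function is finite as soon as `V` is finite dimensional. -/
theorem spectralDensity_ne_top [FiniteDimensional ℂ V] (A : L2 X V →L[ℂ] L2 X V) (x : X)
    (lam : ℝ) : spectralDensity A x lam ≠ ∞ := by
  unfold spectralDensity density
  generalize sqrtOp (spectralProj A lam) = T
  let e := stdOrthonormalBasis ℂ V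
  let w := fun j => ContinuousLinearMap.adjoint T (lp.single 2 x (e j) : L2 X V)
  have key : ∀ f : L2 X V, ‖(T f : X → V) x‖ ^ 2 = ∑ j, ‖inner ℂ f (w j)‖ ^ 2 := by
    intro f
    rw [← e.sum_sq_norm_inner_right]
    refine Finset.sum_congr rfl fun j _ => ?_
    rw [ContinuousLinearMap.adjoint_inner_right, lp.inner_single_right, norm_inner_symm]
  have hs : Summable fun i => ‖(T (hilbBasis (L2 X V) i) : X → V) x‖ ^ 2 := by
    simp only [key]
    refine summable_sum fun j _ => ?_
    have h := (hilbBasis (L2 X V)).summable_inner_mul_inner (w j) (w j)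
    refine h.norm.congr fun i => ?_
    rw [norm_mul, norm_inner_symm, sq]
  have h2 : ∀ i, ‖(T (hilbBasis (L2 X V) i) : X → V) x‖ₑ ^ 2 =
      ENNReal.ofReal (‖(T (hilbBasis (L2 X V) i) : X → V) x‖ ^ 2) := by
    intro i
    rw [ENNReal.ofReal_pow (norm_nonneg _), ofReal_norm]
  simp only [h2]
  exact hs.tsum_ofReal_ne_top

/-- The state `ρ_Ω = χ_Ω Π_lam χ_Ω`. -/
def confinedState (A : L2 X V →L[ℂ] L2 X V) (lam : ℝ) (Ω : Set X) : L2 X V →L[ℂ] L2 X V :=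
  chi Ω ∘L spectralProj A lam ∘L chi Ω

/-- `A` is local at scale `r`: `A f (x)` depends only on the values of `f` in the ball
`B(x, r)`. -/
def IsLocal [PseudoMetricSpace X] (r : ℝ) (A : L2 X V →L[ℂ] L2 X V) : Prop :=
  ∀ (f g : L2 X V) (x : X),
    (∀ y ∈ Metric.closedBall x r, (f : X → V) y = (g : X → V) y) →
      (A f : X → V) x = (A g : X → V) x

/-- The boundary `∂_r Ω = {x | d(x, Ω) ≤ r and d(x, Ωᶜ) ≤ r}`. -/
def boundary [PseudoMetricSpace X] (r : ℝ) (Ω : Set X) : Set X :=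
  Metric.cthickening r Ω ∩ Metric.cthickening r Ωᶜ

/-- The left translation `(g · f)(x) = f(g⁻¹ x)` on `L²(Γ, V)`. -/
def translate {Γ : Type*} [Group Γ] (g : Γ) (f : L2 Γ V) : L2 Γ V :=
  ⟨fun x => (f : Γ → V) (g⁻¹ * x), memℓp_gen
    (((memℓp_gen_iff (by norm_num)).1 (lp.memℓp f)).comp_injective (mul_right_injective g⁻¹))⟩

/-- `A` is translation invariant: it commutes with all the left translations. -/
def IsTranslationInvariant {Γ : Type*} [Group Γ] (A : L2 Γ V →L[ℂ] L2 Γ V) : Prop :=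
  ∀ (g : Γ) (f : L2 Γ V), A (translate g f) = translate g (A f)

end Discrete

end ConfinedState

end

open ConfinedState

set_option linter.unusedSectionVars false

namespace ConfinedState

/-! ### Hilbert–Schmidt sums -/

section HilbertSchmidt

variable {H K : Type*} [NormedAddCommGroup H] [InnerProductSpace ℂ H] [CompleteSpace H]
  [NormedAddCommGroup K] [InnerProductSpace ℂ K] [CompleteSpace K]

/-! Write s for the norm of ρ_Ω and let e be the energy density at a point x, the trace of δ_x* Π_λ
A Π_λ δ_x, where δ_x : V → ℓ²(Γ, V) is `dirac`. By translation invariance neither F nor e depends on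
x.

First, φ(F(λ)) = e (`integral_realInv_spectralDensity`). Between s and t both sides, as functions of
the spectral level, grow by an amount lying between s·ΔF and t·ΔF, so subdividing finely shows that
they differ by a constant, which is 0 below the spectrum.

Second, E(ρ_Ω) differs from |Ω|·e only by interactions between Ω and its complement. By locality
these live on ∂_rΩ and cost at most ‖A‖·F(λ)·|∂_rΩ| (`abs_energy_sub_le`). This gives the first
limit.

Third, F_Ω = |Ω|·F, so the second expression equals s·φ(F(λ)/s), and it suffices that s → 1. Clearly
s ≤ 1. For the lower bound, the inequality λ ≤ A + (A-λ)₋ tested on χ_Ω Π_λ gives λ·F(λ) -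
E(ρ_Ω)/|Ω| ≤ s·J, where J = λ·F(λ) - e is the density of (A-λ)₋ (`le_energy_add`). The left side
tends to J by the second step, and J > 0 unless Π_λ = 0, in which case everything vanishes.

All traces are handled as Hilbert–Schmidt norms and inner products. -/

theorem tsum_enorm_inner_sq {ι : Type*} (b : HilbertBasis ι ℂ H) (v : H) :
    ∑' i, ‖inner ℂ (b i) v‖ₑ ^ 2 = ‖v‖ₑ ^ 2 := by
  have h := b.hasSum_inner_mul_inner v v
  have h2 : HasSum (fun i => ‖inner ℂ (b i) v‖ ^ 2) (‖v‖ ^ 2) := by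
    have h3 := Complex.hasSum_re h
    have e1 : (inner ℂ v v : ℂ).re = ‖v‖ ^ 2 := by
      rw [inner_self_eq_norm_sq_to_K]; norm_cast
    rw [e1] at h3
    refine h3.congr_fun fun i => ?_
    rw [← inner_conj_symm v, mul_comm, Complex.mul_conj, Complex.ofReal_re,
      Complex.normSq_eq_norm_sq]
  have h4 : ∀ w : ℂ, ‖w‖ₑ ^ 2 = ENNReal.ofReal (‖w‖ ^ 2) := fun w => by
    rw [ENNReal.ofReal_pow (norm_nonneg _), ofReal_norm]
  simp only [h4]
  rw [← ENNReal.ofReal_tsum_of_nonneg (fun _ => by positivity) h2.summable, h2.tsum_eq,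
    ENNReal.ofReal_pow (norm_nonneg _), ofReal_norm]

/-- Parseval turns both sides into the double sum of the squared moduli of the matrix coefficients;
in [0, ∞] the order of summation is free. -/
theorem tsum_enorm_sq_adjoint {ι κ : Type*} (b : HilbertBasis ι ℂ H) (c : HilbertBasis κ ℂ K)
    (T : H →L[ℂ] K) :
    ∑' i, ‖T (b i)‖ₑ ^ 2 = ∑' j, ‖ContinuousLinearMap.adjoint T (c j)‖ₑ ^ 2 := by
  simp_rw [← tsum_enorm_inner_sq c (T _), ← tsum_enorm_inner_sq b
    (ContinuousLinearMap.adjoint T _)]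
  rw [ENNReal.tsum_comm]
  refine tsum_congr fun j => tsum_congr fun i => ?_
  rw [ContinuousLinearMap.adjoint_inner_right, ← enorm_norm, norm_inner_symm, enorm_norm]

/-- The square of the Hilbert–Schmidt norm. -/
noncomputable def hsSq (T : H →L[ℂ] K) : ℝ≥0∞ := ∑' i, ‖T (hilbBasis H i)‖ₑ ^ 2

theorem hsSq_adjoint (T : H →L[ℂ] K) : hsSq (ContinuousLinearMap.adjoint T) = hsSq T :=
  (tsum_enorm_sq_adjoint (hilbBasis H) (hilbBasis K) T).symm

theorem tsum_enorm_sq_eq_hsSq {ι : Type*} (b : HilbertBasis ι ℂ H) (T : H →L[ℂ] K) :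
    ∑' i, ‖T (b i)‖ₑ ^ 2 = hsSq T := by
  rw [← hsSq_adjoint, tsum_enorm_sq_adjoint b (hilbBasis K)]; rfl

theorem hsSq_comp_le_left {L : Type*} [NormedAddCommGroup L] [InnerProductSpace ℂ L]
    [CompleteSpace L] (S : K →L[ℂ] L) (T : H →L[ℂ] K) : hsSq (S ∘L T) ≤ ‖S‖ₑ ^ 2 * hsSq T := by
  unfold hsSq
  rw [← ENNReal.tsum_mul_left]
  refine ENNReal.tsum_le_tsum fun i => ?_
  rw [← mul_pow]
  gcongr
  exact S.le_opENorm _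

theorem hsSq_comp_le_right {L : Type*} [NormedAddCommGroup L] [InnerProductSpace ℂ L]
    [CompleteSpace L] (S : K →L[ℂ] L) (T : H →L[ℂ] K) : hsSq (S ∘L T) ≤ hsSq S * ‖T‖ₑ ^ 2 := by
  rw [← hsSq_adjoint, ContinuousLinearMap.adjoint_comp, mul_comm, ← hsSq_adjoint S]
  refine (hsSq_comp_le_left _ _).trans_eq ?_
  rw [← enorm_norm, LinearIsometryEquiv.norm_map, enorm_norm]

theorem hasSum_norm_sq {ι : Type*} (b : HilbertBasis ι ℂ H) {T : H →L[ℂ] K} (hT : hsSq T ≠ ∞) :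
    HasSum (fun i => ‖T (b i)‖ ^ 2) (hsSq T).toReal := by
  have h4 : ∀ i, ‖T (b i)‖ ^ 2 = (‖T (b i)‖ₑ ^ 2).toReal := fun i => by simp
  simp only [h4]
  rw [← tsum_enorm_sq_eq_hsSq b] at hT ⊢
  have h := ENNReal.hasSum_toReal hT
  rwa [← ENNReal.tsum_toReal_eq fun i => ENNReal.ne_top_of_tsum_ne_top hT i] at h

/-- The Hilbert–Schmidt inner product `τ(T* S)`. -/
noncomputable def hsInner (T S : H →L[ℂ] K) : ℂ := ∑' i, inner ℂ (T (hilbBasis H i)) (S (hilbBasis H i))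

theorem norm_inner_le_sq (u v : H) : ‖inner ℂ u v‖ ≤ ‖u‖ ^ 2 + ‖v‖ ^ 2 := by
  have := norm_inner_le_norm (𝕜 := ℂ) u v
  nlinarith [sq_nonneg (‖u‖ - ‖v‖), sq_nonneg ‖u‖, sq_nonneg ‖v‖]

theorem summable_inner {ι : Type*} (b : HilbertBasis ι ℂ H) {T S : H →L[ℂ] K}
    (hT : hsSq T ≠ ∞) (hS : hsSq S ≠ ∞) : Summable fun i => inner ℂ (T (b i)) (S (b i)) :=
  .of_norm_bounded ((hasSum_norm_sq b hT).summable.add (hasSum_norm_sq b hS).summable)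
    fun _ => norm_inner_le_sq _ _

theorem summable_matrix {ι κ : Type*} (b : HilbertBasis ι ℂ H) (c : HilbertBasis κ ℂ K)
    {T : H →L[ℂ] K} (hT : hsSq T ≠ ∞) :
    Summable fun p : ι × κ => ‖inner ℂ (c p.2) (T (b p.1))‖ ^ 2 := by
  have h : ∀ p : ι × κ, ‖inner ℂ (c p.2) (T (b p.1))‖ ^ 2 =
      (‖inner ℂ (c p.2) (T (b p.1))‖ₑ ^ 2).toReal := fun i => by simp
  simp only [h]
  refine ENNReal.summable_toReal ?_
  rw [ENNReal.tsum_prod (f := fun i j => ‖inner ℂ (c j) (T (b i))‖ₑ ^ 2)]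
  simp_rw [tsum_enorm_inner_sq, tsum_enorm_sq_eq_hsSq]
  exact hT

/-- Complex analogue of `tsum_enorm_sq_adjoint`. Exchanging the sums now needs absolute convergence,
which follows from square summability of both matrices. -/
theorem tsum_inner_adjoint {ι κ : Type*} (b : HilbertBasis ι ℂ H) (c : HilbertBasis κ ℂ K)
    {T S : H →L[ℂ] K} (hT : hsSq T ≠ ∞) (hS : hsSq S ≠ ∞) :
    ∑' i, inner ℂ (T (b i)) (S (b i)) =
      ∑' j, inner ℂ (ContinuousLinearMap.adjoint S (c j)) (ContinuousLinearMap.adjoint T (c j)) := by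
  simp_rw [← c.tsum_inner_mul_inner (T _) (S _), ← b.tsum_inner_mul_inner
    (ContinuousLinearMap.adjoint S _) (ContinuousLinearMap.adjoint T _)]
  rw [Summable.tsum_comm]
  · refine tsum_congr fun j => tsum_congr fun i => ?_
    rw [ContinuousLinearMap.adjoint_inner_right, ContinuousLinearMap.adjoint_inner_left, mul_comm]
  · refine Summable.of_norm_bounded (g := fun p : κ × ι => ‖inner ℂ (c p.1) (T (b p.2))‖ ^ 2 +
        ‖inner ℂ (c p.1) (S (b p.2))‖ ^ 2)
      ((summable_matrix b c hT).add (summable_matrix b c hS)).prod_symm fun p => ?_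
    simp only [Function.uncurry]
    rw [norm_mul, norm_inner_symm]
    nlinarith [sq_nonneg (‖inner ℂ (c p.1) (T (b p.2))‖ - ‖inner ℂ (c p.1) (S (b p.2))‖),
      sq_nonneg ‖inner ℂ (c p.1) (T (b p.2))‖, sq_nonneg ‖inner ℂ (c p.1) (S (b p.2))‖]

/-- This is the cyclicity τ(T*S) = τ(ST*). As the basis `c` is arbitrary, it yields `HasTrace` for
products of two Hilbert–Schmidt operators. -/
theorem hasSum_hsInner_adjoint {κ : Type*} (c : HilbertBasis κ ℂ K)
    {T S : H →L[ℂ] K} (hT : hsSq T ≠ ∞) (hS : hsSq S ≠ ∞) :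
    HasSum (fun j => inner ℂ (ContinuousLinearMap.adjoint S (c j))
      (ContinuousLinearMap.adjoint T (c j))) (hsInner T S) := by
  rw [hsInner, tsum_inner_adjoint _ c hT hS]
  exact (summable_inner c (by rwa [hsSq_adjoint]) (by rwa [hsSq_adjoint])).hasSum

theorem hasSum_hsInner {ι : Type*} (b : HilbertBasis ι ℂ H)
    {T S : H →L[ℂ] K} (hT : hsSq T ≠ ∞) (hS : hsSq S ≠ ∞) :
    HasSum (fun i => inner ℂ (T (b i)) (S (b i))) (hsInner T S) := by
  rw [hsInner, tsum_inner_adjoint _ (hilbBasis K) hT hS, ← tsum_inner_adjoint b _ hT hS]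
  exact (summable_inner b hT hS).hasSum

theorem HasTrace.trace_eq {T : H →L[ℂ] H} {t : ℂ} (h : HasTrace T t) : trace T = t := by
  have h' : ∃ t, HasTrace T t := ⟨t, h⟩
  rw [trace, dif_pos h']
  exact (h'.choose_spec _ (hilbBasis H)).unique (h _ (hilbBasis H))

end HilbertSchmidt

/-! ### Spectral projections -/

section Spectral

variable {H : Type*} [NormedAddCommGroup H] [InnerProductSpace ℂ H] [CompleteSpace H]

theorem re_inner_self_eq (v : H) : (inner ℂ v v : ℂ).re = ‖v‖ ^ 2 := by
  rw [inner_self_eq_norm_sq_to_K]; norm_cast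

/-- The negative part `(A - μ)₋`. -/
noncomputable def lowerPart (A : H →L[ℂ] H) (μ : ℝ) : H →L[ℂ] H := cfc (fun t : ℝ => max (μ - t) 0) A

/-- The positive part `(A - μ)₊`. -/
noncomputable def upperPart (A : H →L[ℂ] H) (μ : ℝ) : H →L[ℂ] H := cfc (fun t : ℝ => max (t - μ) 0) A

/-- The square root of `(A - μ)₋`. -/
noncomputable def sqrtLowerPart (A : H →L[ℂ] H) (μ : ℝ) : H →L[ℂ] H :=
  cfc (fun t : ℝ => √(max (μ - t) 0)) A

variable {A : H →L[ℂ] H} {μ μ' : ℝ}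

theorem adjoint_cfc (f : ℝ → ℝ) : ContinuousLinearMap.adjoint (cfc f A) = cfc f A :=
  (cfc_predicate f A : IsSelfAdjoint (cfc f A)).adjoint_eq

theorem inner_cfc (f : ℝ → ℝ) (u v : H) : inner ℂ (cfc f A u) v = inner ℂ u (cfc f A v) := by
  rw [← ContinuousLinearMap.adjoint_inner_left, adjoint_cfc]

theorem cfc_comp_cfc {f g : ℝ → ℝ} (hf : Continuous f) (hg : Continuous g) (v : H) :
    cfc f A (cfc g A v) = cfc (fun t => f t * g t) A v := by
  rw [cfc_mul f g A hf.continuousOn hg.continuousOn]; rfl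

theorem sqrtLowerPart_comp_self (v : H) :
    sqrtLowerPart A μ (sqrtLowerPart A μ v) = lowerPart A μ v := by
  rw [sqrtLowerPart, cfc_comp_cfc (by fun_prop) (by fun_prop)]
  simp only [Real.mul_self_sqrt (le_max_right _ (0 : ℝ))]; rfl

theorem upperPart_comp_lowerPart (v : H) : upperPart A μ (lowerPart A μ v) = 0 := by
  rw [upperPart, lowerPart, cfc_comp_cfc (by fun_prop) (by fun_prop)]
  have : (fun t : ℝ => max (t - μ) 0 * max (μ - t) 0) = fun _ => 0 := by
    ext t
    rcases le_total t μ with h | h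
    · rw [max_eq_right (by linarith), zero_mul]
    · rw [max_eq_right (a := μ - t) (by linarith), mul_zero]
  rw [this, cfc_const_zero]; rfl

theorem apply_eq_upperPart_sub (hA : IsSelfAdjoint A) (μ : ℝ) (v : H) :
    A v = (μ : ℂ) • v + upperPart A μ v - lowerPart A μ v := by
  have h1 : upperPart A μ - lowerPart A μ = A - algebraMap ℝ (H →L[ℂ] H) μ := by
    rw [upperPart, lowerPart, ← cfc_sub _ _ A]
    have : (fun t : ℝ => max (t - μ) 0 - max (μ - t) 0) = fun t => t - μ := by
      ext t
      rcases le_total t μ with h | h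
      · rw [max_eq_right (by linarith), max_eq_left (by linarith)]; ring
      · rw [max_eq_right (a := μ - t) (by linarith), max_eq_left (by linarith)]; ring
    rw [this, cfc_sub (fun t => t) (fun _ => μ) A, cfc_id' ℝ A, cfc_const μ A]
  have h2 := congrArg (fun T : H →L[ℂ] H => T v) h1
  simp only [sub_apply, Algebra.algebraMap_eq_smul_one, smul_apply,
    one_apply_eq_self] at h2
  rw [add_sub_assoc, h2, Complex.coe_smul]
  abel

theorem re_inner_lowerPart (v : H) :
    (inner ℂ v (lowerPart A μ v) : ℂ).re = ‖sqrtLowerPart A μ v‖ ^ 2 := by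
  rw [← sqrtLowerPart_comp_self, sqrtLowerPart, ← inner_cfc, re_inner_self_eq]

theorem re_inner_upperPart_nonneg (v : H) : 0 ≤ (inner ℂ v (upperPart A μ v) : ℂ).re := by
  have h : upperPart A μ v = cfc (fun t : ℝ => √(max (t - μ) 0)) A
      (cfc (fun t : ℝ => √(max (t - μ) 0)) A v) := by
    rw [cfc_comp_cfc (by fun_prop) (by fun_prop)]
    simp only [Real.mul_self_sqrt (le_max_right _ (0 : ℝ))]; rfl
  rw [h, ← inner_cfc, re_inner_self_eq]
  positivity

theorem lowerPart_mem (v : H) : lowerPart A μ v ∈ spectralSubspace A μ :=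
  Submodule.le_topologicalClosure _ ⟨v, rfl⟩

/-- The range of `lowerPart` is dense in the spectral subspace. This reduces facts about the
projections to continuous functional calculus, so no Borel calculus is needed. -/
theorem spectralSubspace_induction {p : H → Prop} (hp : IsClosed {v | p v})
    (h : ∀ v, p (lowerPart A μ v)) {v : H} (hv : v ∈ spectralSubspace A μ) : p v := by
  have hv' : v ∈ closure (LinearMap.range (lowerPart A μ).toLinearMap : Set H) := hv
  refine closure_minimal (t := {v | p v}) ?_ hp hv'
  rintro _ ⟨w, rfl⟩
  exact h w

theorem spectralSubspace_mono (h : μ ≤ μ') : spectralSubspace A μ ≤ spectralSubspace A μ' := by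
  rcases h.eq_or_lt with rfl | h
  · exact le_rfl
  intro v hv
  refine spectralSubspace_induction (p := fun v => v ∈ spectralSubspace A μ')
    (Submodule.isClosed_topologicalClosure _) (fun w => ?_) hv
  -- Factor (μ-t)₊ through (μ'-t)₊. Bounding the denominator below by μ'-μ keeps the quotient
  -- continuous and changes nothing where the numerator is nonzero, since there t < μ.
  have hc : Continuous fun t : ℝ => max (μ - t) 0 / max (μ' - t) (μ' - μ) :=
    Continuous.div (by fun_prop) (by fun_prop) fun t =>
      (lt_of_lt_of_le (sub_pos.2 h) (le_max_right _ _)).ne'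
  have : lowerPart A μ w =
      lowerPart A μ' (cfc (fun t : ℝ => max (μ - t) 0 / max (μ' - t) (μ' - μ)) A w) := by
    rw [lowerPart, lowerPart, cfc_comp_cfc (by fun_prop) hc]
    congr 2
    ext t
    rcases le_total t μ with ht | ht
    · rw [max_eq_left (a := μ' - t) (b := 0) (by linarith),
        max_eq_left (a := μ' - t) (by linarith), mul_div_cancel₀ _ (by linarith)]
    · rw [max_eq_right (a := μ - t) (by linarith)]; simp
  rw [this]
  exact lowerPart_mem _

theorem spectralProj_mem (v : H) : spectralProj A μ v ∈ spectralSubspace A μ :=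
  Submodule.starProjection_apply_mem _ _

theorem spectralProj_eq_self {v : H} (hv : v ∈ spectralSubspace A μ) : spectralProj A μ v = v :=
  Submodule.starProjection_eq_self_iff.2 hv

theorem isStarProjection_spectralProj : IsStarProjection (spectralProj A μ) :=
  isStarProjection_starProjection

theorem adjoint_spectralProj :
    ContinuousLinearMap.adjoint (spectralProj A μ) = spectralProj A μ :=
  isStarProjection_spectralProj.isSelfAdjoint.adjoint_eq

theorem inner_spectralProj (u v : H) :
    inner ℂ (spectralProj A μ u) v = inner ℂ u (spectralProj A μ v) :=
  Submodule.inner_starProjection_left_eq_right _ _ _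

theorem spectralProj_comp_of_le (h : μ ≤ μ') (v : H) :
    spectralProj A μ' (spectralProj A μ v) = spectralProj A μ v :=
  spectralProj_eq_self (spectralSubspace_mono h (spectralProj_mem v))

theorem spectralProj_idem (v : H) :
    spectralProj A μ (spectralProj A μ v) = spectralProj A μ v :=
  spectralProj_comp_of_le le_rfl v

theorem spectralProj_comp_of_ge (h : μ ≤ μ') (v : H) :
    spectralProj A μ (spectralProj A μ' v) = spectralProj A μ v := by
  refine ext_inner_left ℂ fun u => ?_
  rw [← inner_spectralProj, ← inner_spectralProj, spectralProj_comp_of_le h, inner_spectralProj]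

theorem norm_spectralProj_le_one : ‖spectralProj A μ‖ ≤ 1 := Submodule.starProjection_norm_le _

theorem spectralProj_lowerPart (v : H) :
    spectralProj A μ (lowerPart A μ v) = lowerPart A μ v :=
  spectralProj_eq_self (lowerPart_mem v)

theorem lowerPart_spectralProj (v : H) :
    lowerPart A μ (spectralProj A μ v) = lowerPart A μ v := by
  refine ext_inner_left ℂ fun u => ?_
  rw [lowerPart, ← inner_cfc, ← inner_spectralProj, ← lowerPart, spectralProj_lowerPart,
    lowerPart, inner_cfc]

theorem upperPart_spectralProj (v : H) : upperPart A μ (spectralProj A μ v) = 0 :=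
  spectralSubspace_induction (p := fun v => upperPart A μ v = 0)
    (isClosed_eq (by fun_prop) (by fun_prop)) upperPart_comp_lowerPart (spectralProj_mem v)

/-- Since A is self-adjoint, the adjoint of B commutes with A too. Hence B and its adjoint both
preserve the spectral subspace, which therefore reduces B. -/
theorem commute_spectralProj {B : H →L[ℂ] H} (hA : IsSelfAdjoint A) (hB : Commute A B) (v : H) :
    spectralProj A μ (B v) = B (spectralProj A μ v) := by
  have inv : ∀ {C : H →L[ℂ] H}, Commute A C → ∀ w ∈ spectralSubspace A μ,
      C w ∈ spectralSubspace A μ := fun {C} hC w hw => by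
    refine spectralSubspace_induction (p := fun w => C w ∈ spectralSubspace A μ)
      ((Submodule.isClosed_topologicalClosure _).preimage C.continuous) (fun u => ?_) hw
    have h : lowerPart A μ (C u) = C (lowerPart A μ u) :=
      congrArg (fun T : H →L[ℂ] H => T u) (hC.cfc_real fun t => max (μ - t) 0).eq
    rw [← h]
    exact lowerPart_mem _
  have hB' : Commute A (ContinuousLinearMap.adjoint B) := by
    have := hB.star_star
    rwa [hA.star_eq] at this
  refine (Submodule.eq_starProjection_of_mem_orthogonal (inv hB _ (spectralProj_mem v)) ?_)
  rw [← map_sub]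
  refine (Submodule.mem_orthogonal _ _).2 fun u hu => ?_
  rw [← ContinuousLinearMap.adjoint_inner_left]
  exact (Submodule.mem_orthogonal _ _).1 (Submodule.sub_starProjection_mem_orthogonal v) _
    (inv hB' u hu)

theorem spectralProj_apply_comm (hA : IsSelfAdjoint A) (v : H) :
    spectralProj A μ (A v) = A (spectralProj A μ v) :=
  commute_spectralProj hA (Commute.refl A) v

/-- Quadratic form of the identity Π A Π = μΠ - (A-μ)₋: the positive part of A-μ dies on the range
of Π, and the negative part is unchanged by Π. -/
theorem re_inner_spectralProj (hA : IsSelfAdjoint A) (v : H) :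
    (inner ℂ (spectralProj A μ v) (A (spectralProj A μ v)) : ℂ).re =
      μ * ‖spectralProj A μ v‖ ^ 2 - ‖sqrtLowerPart A μ v‖ ^ 2 := by
  rw [apply_eq_upperPart_sub hA μ, upperPart_spectralProj, lowerPart_spectralProj, add_zero,
    inner_sub_right, inner_smul_right, inner_spectralProj v (lowerPart A μ v),
    spectralProj_lowerPart, Complex.sub_re, re_inner_lowerPart, Complex.re_ofReal_mul,
    re_inner_self_eq]

theorem re_inner_le (hA : IsSelfAdjoint A) {v : H} (hv : spectralProj A μ v = v) :
    (inner ℂ v (A v) : ℂ).re ≤ μ * ‖v‖ ^ 2 := by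
  have h := re_inner_spectralProj (μ := μ) hA v
  rw [hv] at h
  nlinarith [sq_nonneg ‖sqrtLowerPart A μ v‖]

/-- The difference of the two sides is the form of (A-μ)₊. The vector is arbitrary, so the bound
applies after a cutoff by χ_Ω, which destroys membership in the spectral subspace. -/
theorem le_re_inner_add (hA : IsSelfAdjoint A) (μ : ℝ) (v : H) :
    μ * ‖v‖ ^ 2 ≤ (inner ℂ v (A v) : ℂ).re + ‖sqrtLowerPart A μ v‖ ^ 2 := by
  rw [apply_eq_upperPart_sub hA μ, inner_sub_right, inner_add_right, inner_smul_right,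
    Complex.sub_re, re_inner_lowerPart, Complex.add_re, Complex.re_ofReal_mul, re_inner_self_eq]
  linarith [re_inner_upperPart_nonneg (A := A) (μ := μ) v]

theorem le_re_inner (hA : IsSelfAdjoint A) {v : H} (hv : spectralProj A μ v = 0) :
    μ * ‖v‖ ^ 2 ≤ (inner ℂ v (A v) : ℂ).re := by
  have h := le_re_inner_add hA μ v
  rw [← re_inner_lowerPart, ← lowerPart_spectralProj, hv, map_zero, inner_zero_right] at h
  simpa using h

theorem abs_re_inner_le (v : H) : |(inner ℂ v (A v) : ℂ).re| ≤ ‖A‖ * ‖v‖ ^ 2 := by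
  refine (Complex.abs_re_le_norm _).trans ((norm_inner_le_norm _ _).trans ?_)
  have := A.le_opNorm v
  nlinarith [norm_nonneg v]

theorem spectralProj_eq_zero (hA : IsSelfAdjoint A) (h : μ < -‖A‖) (v : H) :
    spectralProj A μ v = 0 := by
  have h1 := re_inner_le hA (spectralProj_idem (A := A) (μ := μ) v)
  have h2 := abs_le.1 (abs_re_inner_le (A := A) (spectralProj A μ v))
  have h3 : ‖spectralProj A μ v‖ ^ 2 = 0 := by
    nlinarith [h2.1, sq_nonneg ‖spectralProj A μ v‖]
  simpa using h3

theorem spectralProj_eq (hA : IsSelfAdjoint A) (h : ‖A‖ < μ) (v : H) :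
    spectralProj A μ v = v := by
  have h1 := le_re_inner (v := v - spectralProj A μ v) (μ := μ) hA (by
    rw [map_sub, spectralProj_idem, sub_self])
  have h2 := abs_le.1 (abs_re_inner_le (A := A) (v - spectralProj A μ v))
  have h3 : ‖v - spectralProj A μ v‖ ^ 2 = 0 := by
    nlinarith [h2.2, sq_nonneg ‖v - spectralProj A μ v‖]
  have h4 : v - spectralProj A μ v = 0 := by simpa using h3
  exact (sub_eq_zero.1 h4).symm

theorem norm_sq_spectralProj_add (h : μ ≤ μ') (v : H) :
    ‖spectralProj A μ' v‖ ^ 2 = ‖spectralProj A μ v‖ ^ 2 +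
      ‖spectralProj A μ' v - spectralProj A μ v‖ ^ 2 := by
  have key : inner ℂ (spectralProj A μ v) (spectralProj A μ' v - spectralProj A μ v) = (0 : ℂ) := by
    rw [inner_spectralProj, map_sub, spectralProj_comp_of_ge h, spectralProj_idem, sub_self,
      inner_zero_right]
  have := norm_add_sq_eq_norm_sq_add_norm_sq_of_inner_eq_zero _ _ key
  rw [add_sub_cancel] at this
  simpa only [sq] using this

theorem re_inner_spectralProj_add (hA : IsSelfAdjoint A) (h : μ ≤ μ') (v : H) :
    (inner ℂ (spectralProj A μ' v) (A (spectralProj A μ' v)) : ℂ).re =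
      (inner ℂ (spectralProj A μ v) (A (spectralProj A μ v)) : ℂ).re +
      (inner ℂ (spectralProj A μ' v - spectralProj A μ v)
        (A (spectralProj A μ' v - spectralProj A μ v)) : ℂ).re := by
  have e : spectralProj A μ (spectralProj A μ' v - spectralProj A μ v) = 0 := by
    rw [map_sub, spectralProj_comp_of_ge h, spectralProj_idem, sub_self]
  generalize hw : spectralProj A μ' v - spectralProj A μ v = w at e ⊢
  have hw' : spectralProj A μ' v = spectralProj A μ v + w := by rw [← hw, add_sub_cancel]
  have c1 : inner ℂ (spectralProj A μ v) (A w) = 0 := by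
    rw [inner_spectralProj, spectralProj_apply_comm hA, e, map_zero, inner_zero_right]
  have c2 : inner ℂ w (A (spectralProj A μ v)) = 0 := by
    rw [← spectralProj_apply_comm hA, ← inner_spectralProj, e, inner_zero_left]
  rw [hw', map_add, inner_add_left, inner_add_right, inner_add_right, c1, c2]
  simp

/-- The difference of the projections is the spectral projection of [μ, μ'[, on whose range A lies
between μ and μ'. The cross terms vanish because A commutes with the projections. -/
theorem spectralProj_increment_bounds (hA : IsSelfAdjoint A) (h : μ ≤ μ') (v : H) :
    μ * (‖spectralProj A μ' v‖ ^ 2 - ‖spectralProj A μ v‖ ^ 2) ≤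
      (inner ℂ (spectralProj A μ' v) (A (spectralProj A μ' v)) : ℂ).re -
      (inner ℂ (spectralProj A μ v) (A (spectralProj A μ v)) : ℂ).re ∧
    (inner ℂ (spectralProj A μ' v) (A (spectralProj A μ' v)) : ℂ).re -
      (inner ℂ (spectralProj A μ v) (A (spectralProj A μ v)) : ℂ).re ≤
    μ' * (‖spectralProj A μ' v‖ ^ 2 - ‖spectralProj A μ v‖ ^ 2) := by
  rw [re_inner_spectralProj_add hA h, norm_sq_spectralProj_add h, add_sub_cancel_left,
    add_sub_cancel_left]
  refine ⟨le_re_inner hA ?_, re_inner_le hA ?_⟩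
  · rw [map_sub, spectralProj_comp_of_ge h, spectralProj_idem, sub_self]
  · rw [map_sub, spectralProj_comp_of_le h, spectralProj_idem]

theorem spectralProj_eq_zero_of_sqrtLowerPart (h : ∀ v, sqrtLowerPart A μ v = 0) (v : H) :
    spectralProj A μ v = 0 :=
  spectralSubspace_induction (p := fun w => w = 0) isClosed_singleton
    (fun w => by rw [← sqrtLowerPart_comp_self, h]) (spectralProj_mem v)

theorem sqrtOp_spectralProj : sqrtOp (spectralProj A μ) = spectralProj A μ := by
  have hP : IsStarProjection (spectralProj A μ) := isStarProjection_spectralProj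
  have hs : Set.EqOn Real.sqrt id (spectrum ℝ (spectralProj A μ)) := fun x hx => by
    rcases hP.isIdempotentElem.spectrum_subset ℝ hx with rfl | rfl <;> simp
  rw [sqrtOp, cfc_congr hs, cfc_id ℝ (spectralProj A μ) hP.isSelfAdjoint]

theorem tsum_inner_eq_hsSq {ι : Type*} (b : HilbertBasis ι ℂ H) (T : H →L[ℂ] H) :
    ∑' i, ENNReal.ofReal (RCLike.re (inner ℂ (b i) (ContinuousLinearMap.adjoint T (T (b i))))) =
      hsSq T := by
  rw [← tsum_enorm_sq_eq_hsSq b]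
  refine tsum_congr fun i => ?_
  rw [ContinuousLinearMap.adjoint_inner_right, RCLike.re_eq_complex_re, re_inner_self_eq,
    ENNReal.ofReal_pow (norm_nonneg _), ofReal_norm]

end Spectral

/-! ### The function `φ` as a real integral -/

section Phi

variable {F : ℝ → ℝ≥0∞} {M : ℝ}

theorem le_pseudoInv {x : ℝ} {y : ℝ≥0∞} (h : F x ≤ y) : (x : EReal) ≤ pseudoInv F y :=
  le_sSup ⟨x, h, rfl⟩

theorem pseudoInv_le (hF : Monotone F) {x : ℝ} {y : ℝ≥0∞} (h : y < F x) :
    pseudoInv F y ≤ (x : EReal) := by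
  refine sSup_le ?_
  rintro _ ⟨z, hz, rfl⟩
  refine EReal.coe_le_coe_iff.2 (le_of_not_gt fun hzx => ?_)
  exact (h.trans_le (hF hzx.le)).not_ge hz

theorem pseudoInv_mono : Monotone (pseudoInv F) := fun _ _ h =>
  sSup_le_sSup (Set.image_mono fun _ hx => le_trans hx h)

variable (F) in
/-- The pseudo-inverse with real arguments and values. -/
noncomputable def realInv (u : ℝ) : ℝ := (pseudoInv F (ENNReal.ofReal u)).toReal

theorem measurable_realInv : Measurable (realInv F) :=
  measurable_ereal_toReal.comp
    (Monotone.measurable fun _ _ h => pseudoInv_mono (ENNReal.ofReal_le_ofReal h))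

theorem coe_realInv_bounds (hF : Monotone F) {a b u : ℝ} (ha : F a ≤ ENNReal.ofReal u)
    (hb : ENNReal.ofReal u < F b) :
    pseudoInv F (ENNReal.ofReal u) = (realInv F u : EReal) ∧ a ≤ realInv F u ∧
      realInv F u ≤ b := by
  have h1 := le_pseudoInv ha
  have h2 := pseudoInv_le hF hb
  have h3 : pseudoInv F (ENNReal.ofReal u) = (realInv F u : EReal) :=
    (EReal.coe_toReal (h2.trans_lt (EReal.coe_lt_top b)).ne
      ((EReal.bot_lt_coe a).trans_le h1).ne').symm
  rw [h3] at h1 h2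
  exact ⟨h3, EReal.coe_le_coe_iff.1 h1, EReal.coe_le_coe_iff.1 h2⟩

theorem ofReal_lt_of_lt {u b : ℝ} (hu : 0 ≤ u) (h : u < b) {y : ℝ≥0∞}
    (hb : ENNReal.ofReal b ≤ y) : ENNReal.ofReal u < y :=
  ((ENNReal.ofReal_lt_ofReal_iff (hu.trans_lt h)).2 h).trans_le hb

theorem integrableOn_realInv (hF : Monotone F) (h0 : F (-M) = 0) {a b : ℝ} (ha : 0 ≤ a)
    (hb : ENNReal.ofReal b ≤ F M) : IntegrableOn (realInv F) (Set.Ioc a b) := by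
  -- The endpoint b is removed because F may equal b at M, where the pseudo-inverse can exceed M or
  -- be infinite.
  rw [integrableOn_Ioc_iff_integrableOn_Ioo]
  refine IntegrableOn.of_bound (by simp) measurable_realInv.aestronglyMeasurable M ?_
  refine (ae_restrict_mem measurableSet_Ioo).mono fun u hu => ?_
  have := coe_realInv_bounds hF (a := -M) (b := M) (by simp [h0])
    (ofReal_lt_of_lt (ha.trans hu.1.le) hu.2 hb)
  exact abs_le.2 this.2

theorem intervalIntegrable_realInv (hF : Monotone F) (h0 : F (-M) = 0) {a b : ℝ} (ha : 0 ≤ a)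
    (hab : a ≤ b) (hb : ENNReal.ofReal b ≤ F M) :
    IntervalIntegrable (realInv F) volume a b :=
  (intervalIntegrable_iff_integrableOn_Ioc_of_le hab).2 (integrableOn_realInv hF h0 ha hb)

/-- F vanishes at -M and y ≤ F(M), so the pseudo-inverse stays in [-M, M] on ]0, y[. Both integrals
defining `phi` are then finite and no ∞ - ∞ occurs. -/
theorem phi_eq (hF : Monotone F) (h0 : F (-M) = 0) {y : ℝ} (hy : 0 ≤ y)
    (hb : ENNReal.ofReal y ≤ F M) :
    phi F (ENNReal.ofReal y) = ((∫ u in (0 : ℝ)..y, realInv F u : ℝ) : EReal) := by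
  have hset : {u : ℝ | 0 < u ∧ ENNReal.ofReal u ≤ ENNReal.ofReal y} = Set.Ioc 0 y := by
    ext u
    simp [ENNReal.ofReal_le_ofReal_iff hy]
  have hint := integrableOn_realInv hF h0 le_rfl hb
  have hcoe : ∀ u ∈ Set.Ioo 0 y,
      pseudoInv F (ENNReal.ofReal u) = (realInv F u : EReal) := fun u hu =>
    (coe_realInv_bounds hF (a := -M) (b := M) (by simp [h0])
      (ofReal_lt_of_lt hu.1.le hu.2 hb)).1
  have e1 : ∫⁻ u in Set.Ioc 0 y, (pseudoInv F (ENNReal.ofReal u)).toENNReal =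
      ∫⁻ u in Set.Ioc 0 y, ENNReal.ofReal (realInv F u) := by
    rw [← restrict_Ioo_eq_restrict_Ioc]
    refine setLIntegral_congr_fun measurableSet_Ioo fun u hu => ?_
    simp only [hcoe u hu, EReal.toENNReal_of_ne_top (EReal.coe_ne_top _), EReal.toReal_coe]
  have e2 : ∫⁻ u in Set.Ioc 0 y, (-pseudoInv F (ENNReal.ofReal u)).toENNReal =
      ∫⁻ u in Set.Ioc 0 y, ENNReal.ofReal (-realInv F u) := by
    rw [← restrict_Ioo_eq_restrict_Ioc]
    refine setLIntegral_congr_fun measurableSet_Ioo fun u hu => ?_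
    simp only [hcoe u hu, ← EReal.coe_neg, EReal.toENNReal_of_ne_top (EReal.coe_ne_top _),
      EReal.toReal_coe]
  rw [phi, hset, e1, e2, intervalIntegral.integral_of_le hy,
    integral_eq_lintegral_pos_part_sub_lintegral_neg_part hint, EReal.coe_sub,
    EReal.coe_ennreal_toReal hint.lintegral_lt_top.ne,
    EReal.coe_ennreal_toReal (by simpa using hint.neg.lintegral_lt_top.ne)]

/-- For a < u < b the pseudo-inverse at u lies in [m, m']. This serves both the comparison of `phi`
with the energy density and, with m = -m', a Lipschitz estimate. -/
theorem integral_realInv_bounds (hF : Monotone F) (h0 : F (-M) = 0) {a b m m' : ℝ}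
    (ha : 0 ≤ a) (hab : a ≤ b) (hb : ENNReal.ofReal b ≤ F M)
    (hm : F m ≤ ENNReal.ofReal a) (hm' : ENNReal.ofReal b ≤ F m') :
    m * (b - a) ≤ (∫ u in (0 : ℝ)..b, realInv F u) - (∫ u in (0 : ℝ)..a, realInv F u) ∧
    (∫ u in (0 : ℝ)..b, realInv F u) - (∫ u in (0 : ℝ)..a, realInv F u) ≤ m' * (b - a) := by
  have hb' : ENNReal.ofReal a ≤ F M := (ENNReal.ofReal_le_ofReal hab).trans hb
  rw [intervalIntegral.integral_interval_sub_left
    (intervalIntegrable_realInv hF h0 le_rfl (ha.trans hab) hb)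
    (intervalIntegrable_realInv hF h0 le_rfl ha hb')]
  have hi := intervalIntegrable_realInv hF h0 ha hab hb
  have key : ∀ u ∈ Set.Ioo a b, m ≤ realInv F u ∧ realInv F u ≤ m' := fun u hu =>
    (coe_realInv_bounds hF (hm.trans (ENNReal.ofReal_le_ofReal hu.1.le))
      (ofReal_lt_of_lt (ha.trans hu.1.le) hu.2 hm')).2
  constructor
  · have := intervalIntegral.integral_mono_on_of_le_Ioo hab intervalIntegrable_const hi
      fun u hu => (key u hu).1
    simpa [mul_comm] using this
  · have := intervalIntegral.integral_mono_on_of_le_Ioo hab hi intervalIntegrable_const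
      fun u hu => (key u hu).2
    simpa [mul_comm] using this

theorem realInv_smul {N : ℕ} (hN : N ≠ 0) (u : ℝ) :
    realInv (fun t => (N : ℝ≥0∞) * F t) u = realInv F (u / N) := by
  have hN' : (0 : ℝ) < N := by positivity
  rw [realInv, realInv, pseudoInv, pseudoInv, ENNReal.ofReal_div_of_pos hN', ENNReal.ofReal_natCast]
  congr 3
  ext t
  simp only [Set.mem_ofPred_eq]
  rw [ENNReal.le_div_iff_mul_le (by simp [hN]) (by simp), mul_comm]

theorem integral_realInv_smul {N : ℕ} (hN : N ≠ 0) (y : ℝ) :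
    ∫ u in (0 : ℝ)..(N * y), realInv (fun t => (N : ℝ≥0∞) * F t) u =
      N * ∫ u in (0 : ℝ)..y, realInv F u := by
  have hN' : (N : ℝ) ≠ 0 := by positivity
  simp only [realInv_smul hN]
  rw [intervalIntegral.integral_comp_div _ hN']
  simp [hN']

/-- A function whose increments are dominated by `(b - a) * (G b - G a)` is constant. -/
theorem eq_of_increments_le {K G : ℝ → ℝ} {α β : ℝ} (hαβ : α ≤ β)
    (h : ∀ a b, α ≤ a → a ≤ b → b ≤ β → |K b - K a| ≤ (b - a) * (G b - G a)) : K β = K α := by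
  have key : ∀ n : ℕ, 0 < n → |K β - K α| ≤ (β - α) * (G β - G α) / n := by
    intro n hn
    have hn' : (0 : ℝ) < n := by exact_mod_cast hn
    -- On a uniform subdivision the bounds telescope to the mesh times the total increment of G, so
    -- G may jump.
    set x : ℕ → ℝ := fun i => α + i * ((β - α) / n) with hx
    have hd : 0 ≤ (β - α) / n := div_nonneg (sub_nonneg.2 hαβ) hn'.le
    have h0 : x 0 = α := by simp [hx]
    have h1 : x n = β := by simp only [hx]; field_simp; ring
    have hstep : ∀ i, x (i + 1) - x i = (β - α) / n := fun i => by
      simp only [hx]; push_cast; ring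
    have hmono : Monotone x := monotone_nat_of_le_succ fun i => by linarith [hstep i]
    calc |K β - K α| = |∑ i ∈ Finset.range n, (K (x (i + 1)) - K (x i))| := by
          rw [Finset.sum_range_sub (fun i => K (x i)), h0, h1]
      _ ≤ ∑ i ∈ Finset.range n, |K (x (i + 1)) - K (x i)| := Finset.abs_sum_le_sum_abs _ _
      _ ≤ ∑ i ∈ Finset.range n, ((β - α) / n) * (G (x (i + 1)) - G (x i)) := by
          refine Finset.sum_le_sum fun i hi => ?_
          rw [← hstep i]
          refine h _ _ ?_ (hmono (Nat.le_succ i)) ?_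
          · rw [← h0]; exact hmono (Nat.zero_le _)
          · rw [← h1]; exact hmono (Finset.mem_range.1 hi)
      _ = (β - α) * (G β - G α) / n := by
          rw [← Finset.mul_sum, Finset.sum_range_sub (fun i => G (x i)), h0, h1]; ring
  have hlim : Tendsto (fun n : ℕ => (β - α) * (G β - G α) / n) atTop (𝓝 0) :=
    tendsto_const_div_atTop_nhds_zero_nat _
  have := ge_of_tendsto hlim ((eventually_gt_atTop 0).mono key)
  exact sub_eq_zero.1 (abs_nonpos_iff.1 this)

end Phi

/-! ### Evaluation, localisation and translation on `ℓ²(X, V)` -/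

section L2

variable {X V : Type*} [NormedAddCommGroup V] [InnerProductSpace ℂ V] [CompleteSpace V]

open Classical in
variable (V) in
/-- The inclusion `V → ℓ²(X, V)` of the functions supported at `x`. -/
noncomputable def dirac (x : X) : V →L[ℂ] L2 X V :=
  lp.singleContinuousLinearMap ℂ (fun _ : X => V) 2 x

theorem inner_dirac_right (x : X) (f : L2 X V) (v : V) :
    inner ℂ f (dirac V x v) = inner ℂ ((f : X → V) x) v := by
  classical
  simpa [dirac] using! lp.inner_single_right (𝕜 := ℂ) x v f

theorem adjoint_dirac_apply (x : X) (f : L2 X V) :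
    ContinuousLinearMap.adjoint (dirac V x) f = (f : X → V) x := by
  refine ext_inner_right ℂ fun v => ?_
  rw [ContinuousLinearMap.adjoint_inner_left, inner_dirac_right]

theorem chi_apply (Ω : Set X) (f : L2 X V) (x : X) :
    (chi Ω f : X → V) x = Ω.indicator (f : X → V) x := rfl

theorem inner_chi (Ω : Set X) (f g : L2 X V) : inner ℂ (chi Ω f) g = inner ℂ f (chi Ω g) := by
  rw [lp.inner_eq_tsum, lp.inner_eq_tsum]
  refine tsum_congr fun x => ?_
  rw [chi_apply, chi_apply]
  by_cases h : x ∈ Ω <;> simp [h]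

theorem adjoint_chi (Ω : Set X) :
    ContinuousLinearMap.adjoint (chi Ω : L2 X V →L[ℂ] L2 X V) = chi Ω :=
  ((ContinuousLinearMap.eq_adjoint_iff _ _).2 fun f g => inner_chi Ω f g).symm

theorem chi_chi (Ω : Set X) (f : L2 X V) : chi Ω (chi Ω f) = chi Ω f := by
  refine lp.ext (funext fun x => ?_)
  rw [chi_apply, chi_apply]
  by_cases h : x ∈ Ω <;> simp [h, chi_apply]

theorem norm_chi_apply_le (Ω : Set X) (f : L2 X V) : ‖chi Ω f‖ ≤ ‖f‖ :=
  (norm_indicator_le Ω f).trans_eq (one_mul _)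

theorem inner_chi_finset (Ω : Finset X) (f g : L2 X V) :
    inner ℂ (chi (Ω : Set X) f) g = ∑ x ∈ Ω, inner ℂ ((f : X → V) x) ((g : X → V) x) := by
  rw [lp.inner_eq_tsum, tsum_eq_sum (s := Ω)]
  · refine Finset.sum_congr rfl fun x hx => ?_
    rw [chi_apply, Set.indicator_of_mem (Finset.mem_coe.2 hx)]
  · intro x hx
    rw [chi_apply, Set.indicator_of_notMem (by simpa using hx), inner_zero_left]

theorem enorm_chi_sq (Ω : Finset X) (f : L2 X V) :
    ‖chi (Ω : Set X) f‖ₑ ^ 2 = ∑ x ∈ Ω, ‖(f : X → V) x‖ₑ ^ 2 := by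
  have h : ‖chi (Ω : Set X) f‖ ^ 2 = ∑ x ∈ Ω, ‖(f : X → V) x‖ ^ 2 := by
    rw [← re_inner_self_eq, inner_chi, chi_chi, ← inner_chi, inner_chi_finset, Complex.re_sum]
    simp only [re_inner_self_eq]
  rw [← ofReal_norm, ← ENNReal.ofReal_pow (norm_nonneg _), h,
    ENNReal.ofReal_sum_of_nonneg fun _ _ => by positivity]
  refine Finset.sum_congr rfl fun x _ => ?_
  rw [ENNReal.ofReal_pow (norm_nonneg _), ofReal_norm]

/-- Evaluation at x is the adjoint of `dirac V x`. Taking adjoints thus trades a sum over a basis of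
the source for one over a basis of V. -/
theorem hsSq_adjoint_dirac_comp {H : Type*} [NormedAddCommGroup H] [InnerProductSpace ℂ H]
    [CompleteSpace H] (T : H →L[ℂ] L2 X V) (x : X) :
    hsSq (ContinuousLinearMap.adjoint T ∘L dirac V x) =
      ∑' i, ‖(T (hilbBasis H i) : X → V) x‖ₑ ^ 2 := by
  rw [← hsSq_adjoint, ContinuousLinearMap.adjoint_comp, ContinuousLinearMap.adjoint_adjoint]
  simp only [hsSq, ContinuousLinearMap.comp_apply, adjoint_dirac_apply]

theorem hsSq_chi_comp {H : Type*} [NormedAddCommGroup H] [InnerProductSpace ℂ H]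
    [CompleteSpace H] (Ω : Finset X) (T : H →L[ℂ] L2 X V) :
    hsSq (chi (Ω : Set X) ∘L T) =
      ∑ x ∈ Ω, hsSq (ContinuousLinearMap.adjoint T ∘L dirac V x) := by
  simp only [hsSq_adjoint_dirac_comp]
  simp only [hsSq, ContinuousLinearMap.comp_apply, enorm_chi_sq]
  exact Summable.tsum_finsetSum fun _ _ => ENNReal.summable

theorem hsSq_comp_chi (Ω : Finset X) (T : L2 X V →L[ℂ] L2 X V) :
    hsSq (T ∘L chi (Ω : Set X)) = ∑ x ∈ Ω, hsSq (T ∘L dirac V x) := by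
  rw [← hsSq_adjoint, ContinuousLinearMap.adjoint_comp, adjoint_chi, hsSq_chi_comp,
    ContinuousLinearMap.adjoint_adjoint]

theorem spectralDensity_eq (A : L2 X V →L[ℂ] L2 X V) (x : X) (t : ℝ) :
    spectralDensity A x t = hsSq (spectralProj A t ∘L dirac V x) := by
  rw [spectralDensity, density, sqrtOp_spectralProj, ← hsSq_adjoint_dirac_comp,
    adjoint_spectralProj]

theorem posTrace_confinedState (A : L2 X V →L[ℂ] L2 X V) (t : ℝ) (Ω : Finset X) :
    posTrace (confinedState A t (Ω : Set X)) = ∑ x ∈ Ω, spectralDensity A x t := by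
  have e : confinedState A t (Ω : Set X) =
      ContinuousLinearMap.adjoint (spectralProj A t ∘L chi (Ω : Set X)) ∘L
        (spectralProj A t ∘L chi (Ω : Set X)) := by
    rw [ContinuousLinearMap.adjoint_comp, adjoint_chi, adjoint_spectralProj]
    ext1 f
    simp only [confinedState, ContinuousLinearMap.comp_apply, spectralProj_idem]
  rw [posTrace, e]
  simp only [ContinuousLinearMap.comp_apply]
  simp only [spectralDensity_eq]
  rw [← hsSq_comp_chi, ← tsum_inner_eq_hsSq (hilbBasis (L2 X V))]
  rfl

theorem isPositive_confinedState (A : L2 X V →L[ℂ] L2 X V) (t : ℝ) (Ω : Set X) :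
    (confinedState A t Ω).IsPositive := by
  have h := (ContinuousLinearMap.IsPositive.of_isStarProjection
    (isStarProjection_spectralProj (A := A) (μ := t))).conj_adjoint (chi Ω)
  rwa [adjoint_chi] at h

/-- The C*-identity for T = Π χ_Ω: here T*T is the confined state and T* = χ_Ω Π. -/
theorem enorm_confinedState (A : L2 X V →L[ℂ] L2 X V) (t : ℝ) (Ω : Set X) :
    ‖chi Ω ∘L spectralProj A t‖ₑ ^ 2 = ‖confinedState A t Ω‖ₑ := by
  have h := ContinuousLinearMap.norm_adjoint_comp_self (spectralProj A t ∘L chi Ω)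
  have e : ContinuousLinearMap.adjoint (spectralProj A t ∘L chi Ω) ∘L
        (spectralProj A t ∘L chi Ω) = confinedState A t Ω := by
    rw [ContinuousLinearMap.adjoint_comp, adjoint_chi, adjoint_spectralProj]
    ext1 f
    simp only [confinedState, ContinuousLinearMap.comp_apply, spectralProj_idem]
  have e2 : ‖spectralProj A t ∘L chi Ω‖ = ‖chi Ω ∘L spectralProj A t‖ := by
    rw [← LinearIsometryEquiv.norm_map ContinuousLinearMap.adjoint,
      ContinuousLinearMap.adjoint_comp, adjoint_chi, adjoint_spectralProj]
  rw [e, e2] at h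
  rw [← ofReal_norm, ← ofReal_norm, h, ENNReal.ofReal_mul (norm_nonneg _), sq]

theorem norm_confinedState_le_one (A : L2 X V →L[ℂ] L2 X V) (t : ℝ) (Ω : Set X) :
    ‖confinedState A t Ω‖ ≤ 1 := by
  refine ContinuousLinearMap.opNorm_le_bound _ zero_le_one fun f => ?_
  rw [one_mul]
  refine (norm_chi_apply_le _ _).trans ?_
  refine ((spectralProj A t).le_of_opNorm_le norm_spectralProj_le_one _).trans ?_
  rw [one_mul]
  exact norm_chi_apply_le _ _

theorem chi_comm (Ω Ω' : Set X) (f : L2 X V) : chi Ω (chi Ω' f) = chi Ω' (chi Ω f) := by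
  refine lp.ext (funext fun x => ?_)
  rw [chi_apply, chi_apply]
  by_cases h : x ∈ Ω <;> by_cases h' : x ∈ Ω' <;> simp [h, h', chi_apply]

theorem chi_add_chi_compl (Ω : Set X) (f : L2 X V) : chi Ω f + chi Ωᶜ f = f := by
  refine lp.ext (funext fun x => ?_)
  simp only [lp.coeFn_add, Pi.add_apply, chi_apply]
  by_cases h : x ∈ Ω <;> simp [h]

/-! #### Locality -/

variable [MetricSpace X]

/-- If x in Ω and y outside Ω are at distance at most r, both belong to the boundary. Hence A
couples Ω to its complement only through boundary points on either side. -/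
theorem chi_apply_compl_of_isLocal {r : ℝ} {A : L2 X V →L[ℂ] L2 X V} (hA : IsLocal r A)
    (Ω : Set X) (v : L2 X V) :
    chi Ω (A (chi Ωᶜ v)) = chi (boundary r Ω) (chi Ω (A (chi (boundary r Ω) (chi Ωᶜ v)))) := by
  refine lp.ext (funext fun x => ?_)
  by_cases hx : x ∈ Ω
  swap
  · by_cases hx' : x ∈ boundary r Ω <;> simp [chi_apply, hx, hx']
  by_cases hx' : x ∈ boundary r Ω
  · simp only [chi_apply, Set.indicator_of_mem hx, Set.indicator_of_mem hx']
    refine hA _ _ x fun y hy => ?_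
    by_cases hy' : y ∈ Ω
    · by_cases hb : y ∈ boundary r Ω <;> simp [chi_apply, hy', hb]
    · have hb : y ∈ boundary r Ω := ⟨Metric.mem_cthickening_of_dist_le y x r Ω hx
        (Metric.mem_closedBall.1 hy), Metric.self_subset_cthickening _ hy'⟩
      simp [chi_apply, hb]
  · rw [chi_apply, chi_apply, Set.indicator_of_mem hx, Set.indicator_of_notMem hx']
    have h0 : (A (chi Ωᶜ v) : X → V) x = (A 0 : X → V) x := by
      refine hA _ _ x fun y hy => ?_
      by_cases hy' : y ∈ Ω
      · simp [chi_apply, hy']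
      · exact absurd ⟨Metric.self_subset_cthickening _ hx, Metric.mem_cthickening_of_dist_le x y r
          Ωᶜ hy' (by rw [dist_comm]; exact Metric.mem_closedBall.1 hy)⟩ hx'
    rw [h0, map_zero]; rfl

/-- The difference is, up to sign, the real part of the inner product of χ_Ω v with A applied to the
part of v outside Ω. Locality inserts the boundary cutoff on both sides. -/
theorem abs_re_inner_chi_sub_le {r : ℝ} {A : L2 X V →L[ℂ] L2 X V} (hA : IsLocal r A)
    (Ω : Set X) (v : L2 X V) :
    |(inner ℂ (chi Ω v) (A (chi Ω v))).re - (inner ℂ (chi Ω v) (A v)).re| ≤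
      ‖A‖ * ‖chi (boundary r Ω) v‖ ^ 2 := by
  have h1 : inner ℂ (chi Ω v) (A v) = inner ℂ (chi Ω v) (A (chi Ω v)) +
      inner ℂ (chi Ω v) (A (chi Ωᶜ v)) := by
    rw [← inner_add_right, ← map_add, chi_add_chi_compl]
  have h2 : inner ℂ (chi Ω v) (A (chi Ωᶜ v)) = inner ℂ (chi Ω (chi (boundary r Ω) v))
      (A (chi Ωᶜ (chi (boundary r Ω) v))) := by
    rw [← chi_chi Ω v, inner_chi Ω (chi Ω v), chi_apply_compl_of_isLocal hA, ← inner_chi,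
      ← inner_chi, chi_comm (boundary r Ω) Ω, chi_chi, chi_comm Ωᶜ (boundary r Ω)]
  rw [h1, Complex.add_re, sub_add_cancel_left, abs_neg, h2]
  refine (Complex.abs_re_le_norm _).trans ((norm_inner_le_norm _ _).trans ?_)
  have a1 := norm_chi_apply_le Ω (chi (boundary r Ω) v)
  have a2 := (A.le_opNorm _).trans (mul_le_mul_of_nonneg_left
    (norm_chi_apply_le Ωᶜ (chi (boundary r Ω) v)) (norm_nonneg A))
  calc _ ≤ ‖chi (boundary r Ω) v‖ * (‖A‖ * ‖chi (boundary r Ω) v‖) := by gcongr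
    _ = _ := by ring

end L2

/-! #### Translations -/

section Translation

variable {Γ V : Type*} [Group Γ] [NormedAddCommGroup V] [InnerProductSpace ℂ V] [CompleteSpace V]

theorem inner_translate (g : Γ) (f h : L2 Γ V) :
    inner ℂ (translate g f) (translate g h) = inner ℂ f h := by
  rw [lp.inner_eq_tsum, lp.inner_eq_tsum]
  exact (Equiv.mulLeft g⁻¹).tsum_eq fun x => inner ℂ ((f : Γ → V) x) ((h : Γ → V) x)

theorem norm_translate (g : Γ) (f : L2 Γ V) : ‖translate g f‖ = ‖f‖ := by
  have h := inner_translate g f f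
  have h2 : ‖translate g f‖ ^ 2 = ‖f‖ ^ 2 := by rw [← re_inner_self_eq, h, re_inner_self_eq]
  exact (sq_eq_sq₀ (norm_nonneg _) (norm_nonneg _)).1 h2

/-- The left translation, as a bounded operator. -/
noncomputable def translateCLM (g : Γ) : L2 Γ V →L[ℂ] L2 Γ V :=
  LinearMap.mkContinuous
    { toFun := translate g
      map_add' := fun _ _ => rfl
      map_smul' := fun _ _ => rfl } 1
    fun f => by rw [one_mul]; exact (norm_translate g f).le

theorem translate_dirac (g x : Γ) (v : V) :
    translate g (dirac V x v) = dirac V (g * x) v := by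
  classical
  refine lp.ext (funext fun y => ?_)
  change (lp.single 2 x v : L2 Γ V) (g⁻¹ * y) = (lp.single 2 (g * x) v : L2 Γ V) y
  rw [lp.single_apply, lp.single_apply]
  by_cases h : y = g * x
  · subst h; simp
  · rw [Pi.single_eq_of_ne h, Pi.single_eq_of_ne]
    rintro rfl
    simp at h

theorem IsTranslationInvariant.commute {A : L2 Γ V →L[ℂ] L2 Γ V} (hA : IsTranslationInvariant A)
    (g : Γ) : Commute A (translateCLM g) := by
  ext1 f
  exact hA g f

theorem IsTranslationInvariant.spectralProj {A : L2 Γ V →L[ℂ] L2 Γ V}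
    (hA : IsTranslationInvariant A) (hs : IsSelfAdjoint A) (t : ℝ) :
    IsTranslationInvariant (spectralProj A t) := fun g f =>
  commute_spectralProj hs (hA.commute g) f

theorem hsSq_comp_dirac_eq {T : L2 Γ V →L[ℂ] L2 Γ V} (hT : IsTranslationInvariant T) (x y : Γ) :
    hsSq (T ∘L dirac V x) = hsSq (T ∘L dirac V y) := by
  unfold hsSq
  refine tsum_congr fun i => ?_
  simp only [ContinuousLinearMap.comp_apply]
  rw [show x = x * y⁻¹ * y by group, ← translate_dirac, hT, ← enorm_norm, norm_translate,
    enorm_norm]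

theorem hsInner_comp_dirac_eq {T S : L2 Γ V →L[ℂ] L2 Γ V} (hT : IsTranslationInvariant T)
    (hS : IsTranslationInvariant S) (x y : Γ) :
    hsInner (T ∘L dirac V x) (S ∘L dirac V x) = hsInner (T ∘L dirac V y) (S ∘L dirac V y) := by
  unfold hsInner
  refine tsum_congr fun i => ?_
  simp only [ContinuousLinearMap.comp_apply]
  rw [show x = x * y⁻¹ * y by group, ← translate_dirac, hT, hS, inner_translate]

end Translation

/-! ### Energies -/

section Energy

variable {X V : Type*} [NormedAddCommGroup V] [InnerProductSpace ℂ V] [CompleteSpace V]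
  {A : L2 X V →L[ℂ] L2 X V} {lam : ℝ}

theorem inner_apply_comm {H : Type*} [NormedAddCommGroup H] [InnerProductSpace ℂ H]
    [CompleteSpace H] {A : H →L[ℂ] H} (hA : IsSelfAdjoint A) (u v : H) :
    inner ℂ (A u) v = inner ℂ u (A v) := by
  rw [← ContinuousLinearMap.adjoint_inner_left, hA.adjoint_eq]

theorem hsSq_chi_spectralProj (Ω : Finset X) :
    hsSq (chi (Ω : Set X) ∘L spectralProj A lam) = ∑ x ∈ Ω, spectralDensity A x lam := by
  rw [hsSq_chi_comp, adjoint_spectralProj]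
  simp only [spectralDensity_eq]

theorem hsSq_chi_spectralProj_ne_top (hfin : ∀ x, spectralDensity A x lam ≠ ∞) (Ω : Finset X) :
    hsSq (chi (Ω : Set X) ∘L spectralProj A lam) ≠ ∞ := by
  rw [hsSq_chi_spectralProj]
  exact ENNReal.sum_ne_top.2 fun x _ => hfin x

theorem hsSq_comp_ne_top {H K L : Type*} [NormedAddCommGroup H] [InnerProductSpace ℂ H]
    [CompleteSpace H] [NormedAddCommGroup K] [InnerProductSpace ℂ K] [CompleteSpace K]
    [NormedAddCommGroup L] [InnerProductSpace ℂ L] [CompleteSpace L]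
    (S : K →L[ℂ] L) {T : H →L[ℂ] K} (hT : hsSq T ≠ ∞) : hsSq (S ∘L T) ≠ ∞ :=
  ne_top_of_le_ne_top (ENNReal.mul_ne_top (by simp) hT) (hsSq_comp_le_left S T)

theorem hsSq_eq_zero {H K : Type*} [NormedAddCommGroup H] [InnerProductSpace ℂ H]
    [CompleteSpace H] [NormedAddCommGroup K] [InnerProductSpace ℂ K] [CompleteSpace K]
    {T : H →L[ℂ] K} (hT : hsSq T = 0) (w : K) : ContinuousLinearMap.adjoint T w = 0 := by
  have h : ‖ContinuousLinearMap.adjoint T w‖ₑ ^ 2 = 0 := by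
    rw [← tsum_enorm_inner_sq (hilbBasis H), ENNReal.tsum_eq_zero]
    intro i
    have hi := ENNReal.tsum_eq_zero.1 hT i
    rw [ContinuousLinearMap.adjoint_inner_right]
    simp only [ne_eq, OfNat.ofNat_ne_zero, not_false_eq_true, pow_eq_zero_iff,
      enorm_eq_zero] at hi
    simp [hi]
  simpa using h

/-- ρ_Ω A = S T* with S = χ_Ω Π and T = A χ_Ω Π, both Hilbert–Schmidt. -/
theorem hasTrace_confinedState_aux (hA : IsSelfAdjoint A)
    (hfin : ∀ x, spectralDensity A x lam ≠ ∞) (Ω : Finset X) :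
    HasTrace (confinedState A lam (Ω : Set X) ∘L A)
      (hsInner (A ∘L chi (Ω : Set X) ∘L spectralProj A lam)
        (chi (Ω : Set X) ∘L spectralProj A lam)) := by
  intro ι b
  have hS := hsSq_chi_spectralProj_ne_top hfin Ω
  refine (hasSum_hsInner_adjoint b (hsSq_comp_ne_top A hS) hS).congr_fun fun i => ?_
  simp only [ContinuousLinearMap.adjoint_comp, adjoint_chi, adjoint_spectralProj, hA.adjoint_eq,
    ContinuousLinearMap.comp_apply, confinedState]
  rw [inner_spectralProj, spectralProj_idem, inner_chi]

theorem hasSum_inner_chi (hA : IsSelfAdjoint A)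
    (hfin : ∀ x, spectralDensity A x lam ≠ ∞) (Ω : Finset X) :
    HasSum (fun i => inner ℂ (chi (Ω : Set X) (spectralProj A lam (hilbBasis (L2 X V) i)))
        (A (chi (Ω : Set X) (spectralProj A lam (hilbBasis (L2 X V) i)))))
      (hsInner (A ∘L chi (Ω : Set X) ∘L spectralProj A lam)
        (chi (Ω : Set X) ∘L spectralProj A lam)) := by
  have hS := hsSq_chi_spectralProj_ne_top hfin Ω
  refine (hasSum_hsInner (hilbBasis (L2 X V)) (hsSq_comp_ne_top A hS) hS).congr_fun fun i => ?_
  simp only [ContinuousLinearMap.comp_apply]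
  rw [inner_apply_comm hA]

/-- `energy` keeps only a real part. Nothing is lost: by cyclicity the trace is a sum of terms ⟨v, A
v⟩, real because A is self-adjoint. -/
theorem energy_eq (hA : IsSelfAdjoint A) (hfin : ∀ x, spectralDensity A x lam ≠ ∞)
    (Ω : Finset X) : hsInner (A ∘L chi (Ω : Set X) ∘L spectralProj A lam)
      (chi (Ω : Set X) ∘L spectralProj A lam) =
        ((energy A (confinedState A lam (Ω : Set X)) : ℝ) : ℂ) := by
  rw [energy, (hasTrace_confinedState_aux hA hfin Ω).trace_eq]
  refine Complex.ext (Complex.ofReal_re _).symm ?_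
  rw [Complex.ofReal_im]
  refine (Complex.hasSum_im (hasSum_inner_chi hA hfin Ω)).unique ?_
  refine hasSum_zero.congr_fun fun i => ?_
  refine Complex.conj_eq_iff_im.1 ?_
  rw [inner_conj_symm, inner_apply_comm hA]

theorem hasTrace_confinedState (hA : IsSelfAdjoint A)
    (hfin : ∀ x, spectralDensity A x lam ≠ ∞) (Ω : Finset X) :
    HasTrace (confinedState A lam (Ω : Set X) ∘L A)
      ((energy A (confinedState A lam (Ω : Set X)) : ℝ) : ℂ) := by
  rw [← energy_eq hA hfin]
  exact hasTrace_confinedState_aux hA hfin Ω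

theorem hasSum_energy (hA : IsSelfAdjoint A)
    (hfin : ∀ x, spectralDensity A x lam ≠ ∞) (Ω : Finset X) :
    HasSum (fun i => (inner ℂ (chi (Ω : Set X) (spectralProj A lam (hilbBasis (L2 X V) i)))
        (A (chi (Ω : Set X) (spectralProj A lam (hilbBasis (L2 X V) i))))).re)
      (energy A (confinedState A lam (Ω : Set X))) := by
  have h := Complex.hasSum_re (hasSum_inner_chi hA hfin Ω)
  rwa [energy_eq hA hfin, Complex.ofReal_re] at h

/-- The energy density at `x` of the spectral projection. -/
noncomputable def localEnergy (A : L2 X V →L[ℂ] L2 X V) (x : X) (t : ℝ) : ℝ :=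
  (hsInner (A ∘L spectralProj A t ∘L dirac V x) (spectralProj A t ∘L dirac V x)).re

theorem hasSum_localEnergy (hA : IsSelfAdjoint A) {x : X} {t : ℝ}
    (hfin : spectralDensity A x t ≠ ∞) :
    HasSum (fun j => (inner ℂ (spectralProj A t (dirac V x (hilbBasis V j)))
      (A (spectralProj A t (dirac V x (hilbBasis V j))))).re) (localEnergy A x t) := by
  rw [spectralDensity_eq] at hfin
  refine (Complex.hasSum_re (hasSum_hsInner (hilbBasis V) (hsSq_comp_ne_top A hfin)
    hfin)).congr_fun fun j => ?_
  simp only [ContinuousLinearMap.comp_apply]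
  rw [inner_apply_comm hA]

theorem hasSum_density {x : X} {t : ℝ} (hfin : spectralDensity A x t ≠ ∞) :
    HasSum (fun j => ‖spectralProj A t (dirac V x (hilbBasis V j))‖ ^ 2)
      (spectralDensity A x t).toReal := by
  rw [spectralDensity_eq] at hfin ⊢
  have h := hasSum_norm_sq (hilbBasis V) hfin
  simp only [ContinuousLinearMap.comp_apply] at h
  exact h

/-- Each term differs from that of `hasSum_energy` only by the missing cutoff inside A, so the two
sums can be compared term by term. -/
theorem hasSum_sum_localEnergy (hA : IsSelfAdjoint A)
    (hfin : ∀ x, spectralDensity A x lam ≠ ∞) (Ω : Finset X) :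
    HasSum (fun i => (inner ℂ (chi (Ω : Set X) (spectralProj A lam (hilbBasis (L2 X V) i)))
        (A (spectralProj A lam (hilbBasis (L2 X V) i)))).re)
      (∑ x ∈ Ω, localEnergy A x lam) := by
  simp only [inner_chi_finset, Complex.re_sum]
  refine hasSum_sum fun x _ => ?_
  have h := hfin x
  rw [spectralDensity_eq] at h
  refine (Complex.hasSum_re (hasSum_hsInner_adjoint (hilbBasis (L2 X V)) (hsSq_comp_ne_top A h)
    h)).congr_fun fun i => ?_
  simp only [ContinuousLinearMap.adjoint_comp, adjoint_spectralProj, hA.adjoint_eq,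
    ContinuousLinearMap.comp_apply, adjoint_dirac_apply, spectralProj_apply_comm hA]

theorem abs_energy_sub_le [MetricSpace X] (hA : IsSelfAdjoint A) {r : ℝ} (hloc : IsLocal r A)
    (hfin : ∀ x, spectralDensity A x lam ≠ ∞) (Ω B : Finset X)
    (hB : (B : Set X) = boundary r (Ω : Set X)) :
    |energy A (confinedState A lam (Ω : Set X)) - ∑ x ∈ Ω, localEnergy A x lam| ≤
      ‖A‖ * (∑ x ∈ B, spectralDensity A x lam).toReal := by
  rw [← hsSq_chi_spectralProj]
  refine ((hasSum_energy hA hfin Ω).sub (hasSum_sum_localEnergy hA hfin Ω)).norm_le_of_bounded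
    ((hasSum_norm_sq (hilbBasis (L2 X V)) (hsSq_chi_spectralProj_ne_top hfin B)).mul_left ‖A‖)
    fun i => ?_
  rw [hB]
  exact abs_re_inner_chi_sub_le hloc _ _

/-- By Π A Π = λΠ - (A-λ)₋, the sum is the density of (A-λ)₋ at x. -/
theorem hasSum_norm_sqrtLowerPart (hA : IsSelfAdjoint A) {x : X}
    (hfin : spectralDensity A x lam ≠ ∞) :
    HasSum (fun j => ‖sqrtLowerPart A lam (dirac V x (hilbBasis V j))‖ ^ 2)
      (lam * (spectralDensity A x lam).toReal - localEnergy A x lam) := by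
  refine (((hasSum_density hfin).mul_left lam).sub (hasSum_localEnergy hA hfin)).congr_fun
    fun j => ?_
  rw [re_inner_spectralProj hA]
  ring

theorem hsSq_sqrtLowerPart (hA : IsSelfAdjoint A) {x : X}
    (hfin : spectralDensity A x lam ≠ ∞) :
    hsSq (sqrtLowerPart A lam ∘L dirac V x) =
      ENNReal.ofReal (lam * (spectralDensity A x lam).toReal - localEnergy A x lam) := by
  have h := hasSum_norm_sqrtLowerPart hA hfin
  rw [← h.tsum_eq, ENNReal.ofReal_tsum_of_nonneg (fun _ => by positivity) h.summable]
  refine tsum_congr fun j => ?_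
  rw [ENNReal.ofReal_pow (norm_nonneg _), ofReal_norm]; rfl

theorem lowerEnergy_nonneg (hA : IsSelfAdjoint A) {x : X}
    (hfin : spectralDensity A x lam ≠ ∞) :
    0 ≤ lam * (spectralDensity A x lam).toReal - localEnergy A x lam :=
  (hasSum_norm_sqrtLowerPart hA hfin).nonneg fun _ => by positivity

/-- If the density of (A-λ)₋ vanishes at every point, its square root kills every `dirac` vector.
Its adjoint, which is itself, then has zero values everywhere, and the spectral subspace is trivial.
-/
theorem spectralDensity_eq_zero_of_lowerEnergy (hA : IsSelfAdjoint A)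
    (hfin : ∀ x, spectralDensity A x lam ≠ ∞)
    (h : ∀ x, lam * (spectralDensity A x lam).toReal - localEnergy A x lam = 0) (x : X) :
    spectralDensity A x lam = 0 := by
  have h0 : ∀ f, sqrtLowerPart A lam f = 0 := fun f => by
    refine lp.ext (funext fun y => ?_)
    have hy : hsSq (sqrtLowerPart A lam ∘L dirac V y) = 0 := by
      rw [hsSq_sqrtLowerPart hA (hfin y), h y, ENNReal.ofReal_zero]
    have := hsSq_eq_zero hy f
    rw [ContinuousLinearMap.adjoint_comp, sqrtLowerPart, adjoint_cfc,
      ContinuousLinearMap.comp_apply, adjoint_dirac_apply] at this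
    exact this
  rw [spectralDensity_eq, hsSq]
  simp [spectralProj_eq_zero_of_sqrtLowerPart h0]

/-- Sum λ ≤ A + (A-λ)₋ over the vectors χ_Ω Π e_i. Since χ_Ω is idempotent, the last term is the
squared Hilbert–Schmidt norm of a product of (A-λ)₋^{1/2} χ_Ω with χ_Ω Π, and the second factor has
squared operator norm ‖ρ_Ω‖. -/
theorem le_energy_add (hA : IsSelfAdjoint A) (hfin : ∀ x, spectralDensity A x lam ≠ ∞)
    (Ω : Finset X) :
    lam * (∑ x ∈ Ω, spectralDensity A x lam).toReal ≤
      energy A (confinedState A lam (Ω : Set X)) + ‖confinedState A lam (Ω : Set X)‖ *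
        ∑ x ∈ Ω, (lam * (spectralDensity A x lam).toReal - localEnergy A x lam) := by
  have hS := hsSq_chi_spectralProj_ne_top hfin Ω
  have hR := hsSq_comp_ne_top (sqrtLowerPart A lam) hS
  have h1 : lam * (∑ x ∈ Ω, spectralDensity A x lam).toReal ≤
      energy A (confinedState A lam (Ω : Set X)) +
        (hsSq (sqrtLowerPart A lam ∘L chi (Ω : Set X) ∘L spectralProj A lam)).toReal := by
    rw [← hsSq_chi_spectralProj]
    have s1 := hasSum_norm_sq (hilbBasis (L2 X V)) hS
    have s2 := hasSum_norm_sq (hilbBasis (L2 X V)) hR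
    simp only [ContinuousLinearMap.comp_apply] at s1 s2
    exact hasSum_le (fun i => le_re_inner_add hA lam
      (chi (Ω : Set X) (spectralProj A lam (hilbBasis (L2 X V) i)))) (s1.mul_left lam)
      ((hasSum_energy hA hfin Ω).add s2)
  refine h1.trans (add_le_add_right ?_ _)
  have hnn : 0 ≤ ∑ x ∈ Ω, (lam * (spectralDensity A x lam).toReal - localEnergy A x lam) :=
    Finset.sum_nonneg fun x _ => lowerEnergy_nonneg hA (hfin x)
  refine ENNReal.toReal_le_of_le_ofReal (by positivity) ?_
  have e : sqrtLowerPart A lam ∘L chi (Ω : Set X) ∘L spectralProj A lam =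
      (sqrtLowerPart A lam ∘L chi (Ω : Set X)) ∘L (chi (Ω : Set X) ∘L spectralProj A lam) := by
    ext1 f
    simp only [ContinuousLinearMap.comp_apply, chi_chi]
  rw [e]
  refine (hsSq_comp_le_right _ _).trans_eq ?_
  rw [enorm_confinedState, hsSq_comp_chi, ENNReal.ofReal_mul (norm_nonneg _), ofReal_norm,
    mul_comm, ENNReal.ofReal_sum_of_nonneg fun x _ => lowerEnergy_nonneg hA (hfin x)]
  congr 1
  exact Finset.sum_congr rfl fun x _ => hsSq_sqrtLowerPart hA (hfin x)

/-! ### The spectral density function -/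

theorem spectralDensity_mono (x : X) : Monotone (spectralDensity A x) := by
  intro s t h
  rw [spectralDensity_eq, spectralDensity_eq]
  have e : spectralProj A s ∘L dirac V x = spectralProj A s ∘L (spectralProj A t ∘L dirac V x) := by
    ext1 f
    simp only [ContinuousLinearMap.comp_apply, spectralProj_comp_of_ge h]
  rw [e]
  refine (hsSq_comp_le_left _ _).trans ?_
  have h1 : ‖spectralProj A s‖ₑ ≤ 1 := by
    rw [← ofReal_norm]; exact ENNReal.ofReal_le_one.2 norm_spectralProj_le_one
  calc _ ≤ 1 ^ 2 * hsSq (spectralProj A t ∘L dirac V x) := by gcongr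
    _ = _ := by rw [one_pow, one_mul]

theorem spectralDensity_eq_zero (hA : IsSelfAdjoint A) (x : X) {t : ℝ} (ht : t < -‖A‖) :
    spectralDensity A x t = 0 := by
  rw [spectralDensity_eq, hsSq]
  simp [spectralProj_eq_zero hA ht]

theorem localEnergy_eq_zero (hA : IsSelfAdjoint A) (x : X) {t : ℝ} (ht : t < -‖A‖) :
    localEnergy A x t = 0 := by
  rw [localEnergy, hsInner]
  simp [spectralProj_eq_zero hA ht]

theorem spectralDensity_of_norm_lt (hA : IsSelfAdjoint A) (x : X) {t : ℝ} (ht : ‖A‖ < t) :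
    spectralDensity A x t = hsSq (dirac V x) := by
  rw [spectralDensity_eq]
  congr 1
  ext1 v
  exact spectralProj_eq hA ht _

theorem spectralDensity_le (hA : IsSelfAdjoint A) (x : X) (t : ℝ) :
    spectralDensity A x t ≤ spectralDensity A x (‖A‖ + 1) := by
  refine (spectralDensity_mono x (le_max_left t (‖A‖ + 1))).trans_eq ?_
  rw [spectralDensity_of_norm_lt hA x (by linarith [le_max_right t (‖A‖ + 1)]),
    spectralDensity_of_norm_lt hA x (by linarith)]

/-- Same splitting of χ_Ω as in `le_energy_add`, with the identity in place of (A-λ)₋^{1/2}. It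
keeps τ(ρ_Ω)/‖ρ_Ω‖ in the range where the pseudo-inverse is controlled, even if V is infinite
dimensional. -/
theorem sum_spectralDensity_le (hA : IsSelfAdjoint A) (Ω : Finset X) :
    ∑ x ∈ Ω, spectralDensity A x lam ≤
      (∑ x ∈ Ω, spectralDensity A x (‖A‖ + 1)) * ‖confinedState A lam (Ω : Set X)‖ₑ := by
  have e : chi (Ω : Set X) ∘L spectralProj A lam =
      (ContinuousLinearMap.id ℂ _ ∘L chi (Ω : Set X)) ∘L
        (chi (Ω : Set X) ∘L spectralProj A lam) := by
    ext1 f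
    simp only [ContinuousLinearMap.comp_apply, chi_chi, ContinuousLinearMap.id_apply]
  rw [← hsSq_chi_spectralProj, e]
  refine (hsSq_comp_le_right _ _).trans_eq ?_
  rw [enorm_confinedState, hsSq_comp_chi]
  congr 1
  refine Finset.sum_congr rfl fun x _ => ?_
  rw [spectralDensity_of_norm_lt hA x (by linarith), ContinuousLinearMap.id_comp]

theorem localEnergy_increment_bounds (hA : IsSelfAdjoint A) {x : X} {s t : ℝ} (h : s ≤ t)
    (hfin : spectralDensity A x t ≠ ∞) :
    s * ((spectralDensity A x t).toReal - (spectralDensity A x s).toReal) ≤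
      localEnergy A x t - localEnergy A x s ∧
    localEnergy A x t - localEnergy A x s ≤
      t * ((spectralDensity A x t).toReal - (spectralDensity A x s).toReal) := by
  have hfin' := ne_top_of_le_ne_top hfin (spectralDensity_mono x h)
  have hd := (hasSum_density hfin).sub (hasSum_density hfin')
  have he := (hasSum_localEnergy hA hfin).sub (hasSum_localEnergy hA hfin')
  exact ⟨hasSum_le (fun j => (spectralProj_increment_bounds hA h _).1) (hd.mul_left s) he,
    hasSum_le (fun j => (spectralProj_increment_bounds hA h _).2) he (hd.mul_left t)⟩

/-- The integral up to F(t) and the energy density at level t obey the same increment bounds, so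
`eq_of_increments_le` makes their difference constant. Both vanish at the starting level -(‖A‖+1).
-/
theorem integral_realInv_spectralDensity (hA : IsSelfAdjoint A) {x : X}
    (hfin : spectralDensity A x lam ≠ ∞) :
    ∫ u in (0 : ℝ)..(spectralDensity A x lam).toReal, realInv (spectralDensity A x) u =
      localEnergy A x lam := by
  have h0 : spectralDensity A x (-(‖A‖ + 1)) = 0 := spectralDensity_eq_zero hA x (by linarith)
  rcases le_total lam (-(‖A‖ + 1)) with h | h
  · rw [spectralDensity_eq_zero hA x (by linarith), localEnergy_eq_zero hA x (by linarith)]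
    simp
  have key := eq_of_increments_le (K := fun t => (∫ u in (0 : ℝ)..(spectralDensity A x t).toReal,
    realInv (spectralDensity A x) u) - localEnergy A x t)
    (G := fun t => (spectralDensity A x t).toReal) h fun a b _ hab hb => by
      have hb' := ne_top_of_le_ne_top hfin (spectralDensity_mono x hb)
      have ha' := ne_top_of_le_ne_top hb' (spectralDensity_mono x hab)
      have h1 := localEnergy_increment_bounds hA hab hb'
      have h2 := integral_realInv_bounds (spectralDensity_mono x) h0 (m := a) (m' := b)
        ENNReal.toReal_nonneg (ENNReal.toReal_mono hb' (spectralDensity_mono x hab))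
        (by rw [ENNReal.ofReal_toReal hb']; exact spectralDensity_le hA x b)
        (by rw [ENNReal.ofReal_toReal ha']) (by rw [ENNReal.ofReal_toReal hb'])
      rw [abs_le]
      constructor <;> linarith [h1.1, h1.2, h2.1, h2.2]
  simp only [h0, localEnergy_eq_zero hA x (show -(‖A‖ + 1) < -‖A‖ by linarith),
    ENNReal.toReal_zero, intervalIntegral.integral_same, sub_zero] at key
  exact sub_eq_zero.1 key

theorem phi_spectralDensity (hA : IsSelfAdjoint A) {x : X}
    (hfin : spectralDensity A x lam ≠ ∞) :
    phi (spectralDensity A x) (spectralDensity A x lam) = (localEnergy A x lam : EReal) := by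
  conv_lhs => rw [← ENNReal.ofReal_toReal hfin]
  rw [phi_eq (spectralDensity_mono x) (M := ‖A‖ + 1) (spectralDensity_eq_zero hA x (by linarith))
    ENNReal.toReal_nonneg (by rw [ENNReal.ofReal_toReal hfin]; exact spectralDensity_le hA x _),
    integral_realInv_spectralDensity hA hfin]

end Energy

/-! ### Translation invariant operators -/

section Invariant

variable {Γ V : Type*} [Group Γ] [NormedAddCommGroup V] [InnerProductSpace ℂ V] [CompleteSpace V]
  {A : L2 Γ V →L[ℂ] L2 Γ V} {lam : ℝ}

theorem spectralDensity_const (hA : IsSelfAdjoint A) (hinv : IsTranslationInvariant A)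
    (x y : Γ) (t : ℝ) : spectralDensity A x t = spectralDensity A y t := by
  rw [spectralDensity_eq, spectralDensity_eq,
    hsSq_comp_dirac_eq (hinv.spectralProj hA t) x y]

theorem localEnergy_const (hA : IsSelfAdjoint A) (hinv : IsTranslationInvariant A)
    (x y : Γ) (t : ℝ) : localEnergy A x t = localEnergy A y t := by
  have h : IsTranslationInvariant (A ∘L spectralProj A t) := fun g f => by
    rw [ContinuousLinearMap.comp_apply, hinv.spectralProj hA t, hinv]; rfl
  exact congrArg Complex.re (hsInner_comp_dirac_eq h (hinv.spectralProj hA t) x y)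

theorem sum_spectralDensity (hA : IsSelfAdjoint A) (hinv : IsTranslationInvariant A)
    (x : Γ) (t : ℝ) (Ω : Finset Γ) :
    ∑ y ∈ Ω, spectralDensity A y t = Ω.card * spectralDensity A x t := by
  rw [Finset.sum_congr rfl fun y _ => spectralDensity_const hA hinv y x t, Finset.sum_const,
    nsmul_eq_mul]

theorem sum_localEnergy (hA : IsSelfAdjoint A) (hinv : IsTranslationInvariant A)
    (x : Γ) (t : ℝ) (Ω : Finset Γ) :
    ∑ y ∈ Ω, localEnergy A y t = Ω.card * localEnergy A x t := by
  rw [Finset.sum_congr rfl fun y _ => localEnergy_const hA hinv y x t, Finset.sum_const,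
    nsmul_eq_mul]

theorem spectralMeasure_eq (hA : IsSelfAdjoint A) (hinv : IsTranslationInvariant A)
    (x : Γ) (Ω : Finset Γ) :
    spectralMeasure A (Ω : Set Γ) = fun t => (Ω.card : ℝ≥0∞) * spectralDensity A x t := by
  ext t
  rw [← sum_spectralDensity hA hinv]
  exact posTrace_confinedState A t Ω

theorem posTrace_div_eq (hA : IsSelfAdjoint A) (hinv : IsTranslationInvariant A) {x : Γ}
    (hfin : spectralDensity A x lam ≠ ∞) (Ω : Finset Γ) :
    posTrace (confinedState A lam (Ω : Set Γ)) / ‖confinedState A lam (Ω : Set Γ)‖ₑ =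
      ENNReal.ofReal (Ω.card *
        ((spectralDensity A x lam).toReal / ‖confinedState A lam (Ω : Set Γ)‖)) := by
  have hle := sum_spectralDensity_le (lam := lam) hA Ω
  rw [posTrace_confinedState]
  rw [sum_spectralDensity hA hinv x] at hle ⊢
  rcases (norm_nonneg (confinedState A lam (Ω : Set Γ))).eq_or_lt with h | h
  -- A zero norm forces a zero trace, and 0/0 = 0 both in [0, ∞] and in ℝ.
  · rw [← enorm_norm, ← h, enorm_zero, mul_zero] at hle
    rw [← h, nonpos_iff_eq_zero.1 hle]
    simp
  · rw [ENNReal.ofReal_mul (by positivity), ENNReal.ofReal_div_of_pos h,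
      ENNReal.ofReal_toReal hfin, ofReal_norm, ENNReal.ofReal_natCast, mul_div_assoc]

theorem density_div_norm_le (hA : IsSelfAdjoint A) (hinv : IsTranslationInvariant A) {x : Γ}
    (hfin : spectralDensity A x lam ≠ ∞) {Ω : Finset Γ} (hΩ : Ω.Nonempty) :
    ENNReal.ofReal ((spectralDensity A x lam).toReal / ‖confinedState A lam (Ω : Set Γ)‖) ≤
      spectralDensity A x (‖A‖ + 1) := by
  have hle := sum_spectralDensity_le (lam := lam) hA Ω
  rw [sum_spectralDensity hA hinv x, sum_spectralDensity hA hinv x, mul_assoc,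
    ENNReal.mul_le_mul_iff_right (by simpa using hΩ.ne_empty) (by simp)] at hle
  rcases (norm_nonneg (confinedState A lam (Ω : Set Γ))).eq_or_lt with h | h
  · rw [← h]; simp
  · rw [ENNReal.ofReal_div_of_pos h, ENNReal.ofReal_toReal hfin, ofReal_norm]
    exact ENNReal.div_le_of_le_mul hle

theorem phi_spectralMeasure (hA : IsSelfAdjoint A) (hinv : IsTranslationInvariant A) {x : Γ}
    (hfin : spectralDensity A x lam ≠ ∞) {Ω : Finset Γ} (hΩ : Ω.Nonempty) :
    phi (spectralMeasure A (Ω : Set Γ))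
      (posTrace (confinedState A lam (Ω : Set Γ)) / ‖confinedState A lam (Ω : Set Γ)‖ₑ) =
    ((Ω.card * ∫ u in (0 : ℝ)..((spectralDensity A x lam).toReal /
      ‖confinedState A lam (Ω : Set Γ)‖), realInv (spectralDensity A x) u : ℝ) : EReal) := by
  rw [posTrace_div_eq hA hinv hfin, spectralMeasure_eq hA hinv x,
    phi_eq (M := ‖A‖ + 1) _ _ (by positivity), integral_realInv_smul hΩ.card_pos.ne']
  · rw [ENNReal.ofReal_mul (by positivity), ENNReal.ofReal_natCast]
    gcongr
    exact density_div_norm_le hA hinv hfin hΩ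
  · exact fun s t h => mul_le_mul_right (spectralDensity_mono x h) _
  · rw [spectralDensity_eq_zero hA x (by linarith), mul_zero]

theorem tendsto_energy [MetricSpace Γ] (hA : IsSelfAdjoint A) (hinv : IsTranslationInvariant A)
    {r : ℝ} (hloc : IsLocal r A) (hfin : ∀ x : Γ, spectralDensity A x lam ≠ ∞)
    {Ω : ℕ → Finset Γ} (hne : ∀ n, (Ω n).Nonempty)
    (hΩ : Tendsto (fun n => ((boundary r (Ω n : Set Γ)).encard : ℝ≥0∞) / ((Ω n).card : ℝ≥0∞))
      atTop (𝓝 0)) (x : Γ) :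
    Tendsto (fun n => energy A (confinedState A lam (Ω n : Set Γ)) / ((Ω n).card : ℝ)) atTop
      (𝓝 (localEnergy A x lam)) := by
  have hlim : Tendsto (fun n => ‖A‖ * (spectralDensity A x lam).toReal *
      (((boundary r (Ω n : Set Γ)).encard : ℝ≥0∞) / ((Ω n).card : ℝ≥0∞)).toReal) atTop (𝓝 0) := by
    have := ((ENNReal.tendsto_toReal ENNReal.zero_ne_top).comp hΩ).const_mul
      (‖A‖ * (spectralDensity A x lam).toReal)
    simpa using this
  refine tendsto_iff_norm_sub_tendsto_zero.2 (squeeze_zero' (.of_forall fun _ => norm_nonneg _) ?_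
    hlim)
  -- Balls are not assumed finite, so the boundary might be infinite; a ratio below 1 excludes this
  -- for large n.
  filter_upwards [hΩ.eventually_lt_const one_pos] with n hn
  have hcard : (0 : ℝ) < (Ω n).card := by exact_mod_cast (hne n).card_pos
  have hfinite : (boundary r (Ω n : Set Γ)).Finite := by
    rw [← Set.encard_ne_top_iff]
    intro htop
    rw [htop, ENat.toENNReal_top, ENNReal.top_div_of_ne_top (by simp)] at hn
    simp at hn
  have h := abs_energy_sub_le hA hloc hfin (Ω n) hfinite.toFinset hfinite.coe_toFinset
  rw [sum_localEnergy hA hinv x, sum_spectralDensity hA hinv x] at h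
  have e : energy A (confinedState A lam (Ω n : Set Γ)) / ((Ω n).card : ℝ) - localEnergy A x lam =
      (energy A (confinedState A lam (Ω n : Set Γ)) - (Ω n).card * localEnergy A x lam) /
        (Ω n).card := by
    field_simp
  rw [e, Real.norm_eq_abs, abs_div, abs_of_pos hcard, hfinite.encard_eq_coe_toFinset_card,
    div_le_iff₀ hcard]
  refine h.trans_eq ?_
  simp only [ENat.toENNReal_coe, ENNReal.toReal_mul, ENNReal.toReal_natCast, ENNReal.toReal_div]
  field_simp

/-- Squeeze: `le_energy_add` divided by |Ω|·J bounds the norm below by a quantity tending to J/J,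
and 1 bounds it above. -/
theorem tendsto_norm_confinedState (hA : IsSelfAdjoint A) (hinv : IsTranslationInvariant A)
    (hfin : ∀ x : Γ, spectralDensity A x lam ≠ ∞)
    {Ω : ℕ → Finset Γ} (hne : ∀ n, (Ω n).Nonempty) {x : Γ} (h0 : spectralDensity A x lam ≠ 0)
    (hE : Tendsto (fun n => energy A (confinedState A lam (Ω n : Set Γ)) / ((Ω n).card : ℝ)) atTop
      (𝓝 (localEnergy A x lam))) :
    Tendsto (fun n => ‖confinedState A lam (Ω n : Set Γ)‖) atTop (𝓝 1) := by
  set F := (spectralDensity A x lam).toReal with hF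
  set J := lam * F - localEnergy A x lam with hJ
  have hJpos : 0 < J := by
    refine (lowerEnergy_nonneg hA (hfin x)).lt_of_ne fun h => h0 ?_
    refine spectralDensity_eq_zero_of_lowerEnergy hA hfin (fun y => ?_) x
    rw [spectralDensity_const hA hinv y x, localEnergy_const hA hinv y x]
    exact h.symm
  have hlow : Tendsto (fun n => (lam * F -
      energy A (confinedState A lam (Ω n : Set Γ)) / ((Ω n).card : ℝ)) / J) atTop (𝓝 1) := by
    have := (hE.const_sub (lam * F)).div_const J
    rwa [← hJ, div_self hJpos.ne'] at this
  refine tendsto_of_tendsto_of_tendsto_of_le_of_le hlow tendsto_const_nhds (fun n => ?_)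
    fun n => norm_confinedState_le_one A lam _
  have hcard : (0 : ℝ) < (Ω n).card := by exact_mod_cast (hne n).card_pos
  have h := le_energy_add hA hfin (Ω n)
  rw [Finset.sum_sub_distrib, ← Finset.mul_sum, ← ENNReal.toReal_sum fun y _ => hfin y,
    sum_spectralDensity hA hinv x, sum_localEnergy hA hinv x, ENNReal.toReal_mul,
    ENNReal.toReal_natCast, ← hF] at h
  rw [div_le_iff₀ hJpos, sub_le_iff_le_add, ← mul_le_mul_iff_left₀ hcard, add_mul,
    div_mul_cancel₀ _ hcard.ne', hJ]
  linarith

theorem tendsto_norm_mul_integral (hA : IsSelfAdjoint A) (hinv : IsTranslationInvariant A)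
    (hfin : ∀ x : Γ, spectralDensity A x lam ≠ ∞)
    {Ω : ℕ → Finset Γ} (hne : ∀ n, (Ω n).Nonempty) (x : Γ)
    (hE : Tendsto (fun n => energy A (confinedState A lam (Ω n : Set Γ)) / ((Ω n).card : ℝ)) atTop
      (𝓝 (localEnergy A x lam))) :
    Tendsto (fun n => ‖confinedState A lam (Ω n : Set Γ)‖ *
      ∫ u in (0 : ℝ)..((spectralDensity A x lam).toReal /
        ‖confinedState A lam (Ω n : Set Γ)‖), realInv (spectralDensity A x) u) atTop
      (𝓝 (localEnergy A x lam)) := by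
  have hI := integral_realInv_spectralDensity hA (hfin x)
  have hF0 : 0 ≤ (spectralDensity A x lam).toReal := ENNReal.toReal_nonneg
  -- If F(λ) = 0 the norms are not known to tend to 1, but every integral is over a trivial
  -- interval.
  rcases eq_or_ne (spectralDensity A x lam) 0 with h0 | h0
  · rw [← hI, h0]
    simp
  have hs := tendsto_norm_confinedState hA hinv hfin hne h0 hE
  have hz : spectralDensity A x (-(‖A‖ + 1)) = 0 := spectralDensity_eq_zero hA x (by linarith)
  have hD := fun n => density_div_norm_le hA hinv (hfin x) (hne n)
  have hle := fun n => norm_confinedState_le_one A lam (Ω n : Set Γ)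
  rw [← hI]
  set q := realInv (spectralDensity A x)
  set F := (spectralDensity A x lam).toReal
  -- Write s·φ(F/s) - φ(F) = s·(φ(F/s) - φ(F)) - (1-s)·φ(F). As the pseudo-inverse is bounded by
  -- ‖A‖+1, the first term is at most s·(‖A‖+1)·(F/s - F) = (‖A‖+1)·F·(1-s) in modulus.
  refine tendsto_iff_norm_sub_tendsto_zero.2 (squeeze_zero' (.of_forall fun _ => norm_nonneg _) ?_
    (g := fun n => ((‖A‖ + 1) * F + |∫ u in (0 : ℝ)..F, q u|) *
      (1 - ‖confinedState A lam (Ω n : Set Γ)‖)) ?_)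
  · filter_upwards [hs.eventually_const_lt zero_lt_one] with n hn
    have hb := integral_realInv_bounds (spectralDensity_mono x) hz (m := -(‖A‖ + 1))
      (m' := ‖A‖ + 1) hF0 (le_div_self hF0 hn (hle n)) (hD n) (by rw [hz]; exact zero_le) (hD n)
    have hs1 := hle n
    generalize ‖confinedState A lam (Ω n : Set Γ)‖ = s at hn hb hs1 ⊢
    have e : s * ((‖A‖ + 1) * (F / s - F)) = (‖A‖ + 1) * F * (1 - s) := by field_simp
    have h1 := mul_le_mul_of_nonneg_left hb.1 hn.le
    have h2 := mul_le_mul_of_nonneg_left hb.2 hn.le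
    rw [neg_mul, mul_neg, e] at h1
    rw [e] at h2
    have h3 := mul_le_mul_of_nonneg_right (le_abs_self (∫ u in (0 : ℝ)..F, q u))
      (sub_nonneg.2 hs1)
    have h4 := mul_le_mul_of_nonneg_right (neg_abs_le (∫ u in (0 : ℝ)..F, q u))
      (sub_nonneg.2 hs1)
    rw [Real.norm_eq_abs, abs_le]
    constructor <;> linarith
  · simpa using (hs.const_sub 1).const_mul ((‖A‖ + 1) * F + |∫ u in (0 : ℝ)..F, q u|)

end Invariant

end ConfinedState

/-! ### Conclusion: finiteness and the two limits -/

open ConfinedState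
theorem mainTheorem9
    {Γ : Type*} [Group Γ] [MetricSpace Γ]
    (hdist : ∀ g x y : Γ, dist (g * x) (g * y) = dist x y)
    {V : Type*} [NormedAddCommGroup V] [InnerProductSpace ℂ V] [CompleteSpace V]
    (A : L2 Γ V →L[ℂ] L2 Γ V)
    (hA : IsSelfAdjoint A)
    (hinv : IsTranslationInvariant A)
    (r : ℝ) (hloc : IsLocal r A)
    (lam : ℝ) (hfin : ∀ x : Γ, spectralDensity A x lam ≠ ∞)
    (Ω : ℕ → Finset Γ) (hne : ∀ n, (Ω n).Nonempty)
    (hΩ : Tendsto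
      (fun n => ((boundary r (Ω n : Set Γ)).encard : ℝ≥0∞) / ((Ω n).card : ℝ≥0∞))
      atTop (𝓝 0)) :
    -- `F_x` does not depend on `x`
    (∀ (x y : Γ) (t : ℝ), spectralDensity A x t = spectralDensity A y t) ∧
    -- all the quantities involved are well defined and finite
    (∀ n, IsState (confinedState A lam (Ω n : Set Γ)) ∧
      HasTrace (confinedState A lam (Ω n : Set Γ) ∘L A)
        ((energy A (confinedState A lam (Ω n : Set Γ)) : ℝ) : ℂ) ∧
      phi (spectralMeasure A (Ω n : Set Γ))
        (posTrace (confinedState A lam (Ω n : Set Γ)) /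
          ‖confinedState A lam (Ω n : Set Γ)‖ₑ) ∉ ({⊥, ⊤} : Set EReal)) ∧
    (∀ x : Γ,
      phi (spectralDensity A x)
        (spectralDensity A x lam) ∉ ({⊥, ⊤} : Set EReal) ∧
      -- the two limits
      Tendsto
        (fun n => energy A (confinedState A lam (Ω n : Set Γ)) /
          ((Ω n).card : ℝ))
        atTop
        (𝓝 (phi (spectralDensity A x)
          (spectralDensity A x lam)).toReal) ∧
      Tendsto
        (fun n => ‖confinedState A lam (Ω n : Set Γ)‖ *
          (phi (spectralMeasure A (Ω n : Set Γ))
            (posTrace (confinedState A lam (Ω n : Set Γ)) /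
              ‖confinedState A lam (Ω n : Set Γ)‖ₑ)).toReal /
          ((Ω n).card : ℝ))
        atTop
        (𝓝 (phi (spectralDensity A x)
          (spectralDensity A x lam)).toReal)) := by
  refine ⟨spectralDensity_const hA hinv, fun n => ⟨⟨isPositive_confinedState A lam _, ?_⟩,
    hasTrace_confinedState hA hfin (Ω n), ?_⟩, fun x => ⟨?_, ?_, ?_⟩⟩
  · rw [posTrace_confinedState]
    exact ENNReal.sum_ne_top.2 fun x _ => hfin x
  · rw [phi_spectralMeasure hA hinv (hfin (hne n).choose) (hne n)]
    simp [-EReal.coe_mul]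
  · rw [phi_spectralDensity hA (hfin x)]
    simp
  · rw [phi_spectralDensity hA (hfin x), EReal.toReal_coe]
    exact tendsto_energy hA hinv hloc hfin hne hΩ x
  · rw [phi_spectralDensity hA (hfin x), EReal.toReal_coe]
    refine (tendsto_norm_mul_integral hA hinv hfin hne x
      (tendsto_energy hA hinv hloc hfin hne hΩ x)).congr fun n => ?_
    have hcard : ((Ω n).card : ℝ) ≠ 0 := by exact_mod_cast (hne n).card_pos.ne'
    rw [phi_spectralMeasure hA hinv (hfin x) (hne n), EReal.toReal_coe]
    field_simp
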